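/- Work with smooth manifolds over $\mathbb R$ or with complex manifolds (finite-dimensional; objects and resolutions Hausdorff and second countable). A Lie groupoid $\Gamma\rightrightarrows M$ has source $s$, target $t$, and a product $\gamma\gamma'$ defined when $t(\gamma)=s(\gamma')$; a right $\Gamma$-module is a manifold $Z$ with a smooth map $\phi:Z\to M$ and a smooth action $z\cdot\gamma$, defined when $\phi(z)=s(\gamma)$, with $\phi(z\cdot\gamma)=t(\gamma)$. Let $\mathcal S\subset M$ be a nonempty embedded submanifold that is $\Gamma$-stable, i.e. $s(\gamma)\in\mathcal S\iff t(\gamma)\in\mathcal S$. A $\Gamma$-resolution of $\overline{\mathcal S}$ is a right $\Gamma$-module $(Z,\phi)$ such that $\phi^{-1}(\mathcal S)$ is dense in $Z$ and $\phi$ restricts to a diffeomorphism (biholomorphism) $\phi^{-1}(\mathcal S)\to\mathcal S$; two of them coincide if there is an equivariant diffeomorphism (biholomorphism) over $M$ between them. For a Morita equivalence $\mathcal X$ from $\Gamma\rightrightarrows M$ to $\Gamma'\rightrightarrows M'$, given by a bimodule $X$ with anchor maps $p:X\to M$, $p':X\to M'$, write $\underline{\mathcal X}(Z,\phi)$ for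 the right $\Gamma'$-module $(Z\times_M X)/\big((z,x)\sim(z\gamma^{-1},\gamma x)\big)$ with anchor $[z,x]\mapsto p'(x)$, and $\underline{\mathcal X}(\mathcal S)=p'(p^{-1}(\mathcal S))$. Let $(Z,\phi)$ be a $\Gamma$-resolution of $\overline{\mathcal S}$. Let $\widehat\Gamma=(\Gamma\rightrightarrows M)\times(Z\times Z\rightrightarrows Z)$ be the product with the pair groupoid, with objects $M\times Z$, and let $\widehat{\mathcal S}=\mathcal S\times Z$. Let $\mathcal X$ be the bimodule $X=\Gamma\times Z$ with $p(\gamma,z)=s(\gamma)$, $p'(\gamma,z)=(t(\gamma),z)$, $\gamma'\cdot(\gamma,z)=(\gamma'\gamma,z)$ and $(\gamma,z)\cdot(\gamma',(z,z'))=(\gamma\gamma',z')$. Then: 1. $\widehat\Gamma$ is a Lie groupoid, $\mathcal X$ is a Morita equivalence between $\Gamma$ and $\widehat\Gamma$, $\underline{\mathcal X}(\mathcal S)=\widehat{\mathcal S}$ is an embedded $\widehat\Gamma$-stable submanifold, and $\underline{\mathcal X}(Z,\phi)$ is a manifold and coincides with the $\widehat\Gamma$-resolution $(\widehat Z,\widehat\phi)=(Z\times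 Z,\phi\times\mathrm{id})$ of $\overline{\widehat{\mathcal S}}$, on which $(z,z_1)\cdot(\gamma,(z_1,z_2))=(z\cdot\gamma,z_2)$. 2. Let $\widehat L=\{(\phi(z),z):z\in Z\}$. Then $(\widehat Z,\widehat\phi)$ is $\widehat L$-compatible via the diagonal $\Delta\subset Z\times Z$: $\widehat L$ is an embedded submanifold in which $\widehat L\cap\widehat{\mathcal S}$ is dense, $\Delta$ is an embedded submanifold which $\widehat\phi$ maps diffeomorphically (biholomorphically) onto $\widehat L$, and $\Delta$ is transverse to the $\widehat\Gamma$-orbits in $\widehat Z$ and meets all those contained in $\widehat\phi^{-1}(\widehat{\mathcal S})$. 3. Let $\psi:\widehat L\to\Delta$ be the inverse of $\widehat\phi|_\Delta$ and $\widehat R=\{r\in\widehat\Gamma: s(r)\in\widehat L,\ \psi(s(r))\cdot r\in\Delta\}$. Then $\widehat R\rightrightarrows\widehat L$ is a Lie subgroupoid of $\widehat\Gamma$, closed in the set of arrows with source and target in $\widehat L$, and full in $\widehat{\mathcal S}$: $\widehat L\cap\widehat{\mathcal S}$ is dense in $\widehat L$, $\widehat L$ meets all $\widehat\Gamma$-orbits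 contained in $\widehat{\mathcal S}$ and intersects them transversally in $\widehat{\mathcal S}$, and every arrow of $\widehat\Gamma$ between two points of $\widehat L\cap\widehat{\mathcal S}$ lies in $\widehat R$. 4. The quotient $Z(\widehat R)=\widehat R\backslash s^{-1}(\widehat L)$, with $\phi_{\widehat R}[\gamma]=t(\gamma)$ and $[\gamma]\cdot\gamma'=[\gamma\gamma']$, is a manifold and a $\widehat\Gamma$-resolution of $\overline{\widehat{\mathcal S}}$; it coincides with $(\widehat Z,\widehat\phi)$. Moreover, with $\mathcal X^{-1}$ the inverse bimodule, $\underline{\mathcal X^{-1}}(Z(\widehat R),\phi_{\widehat R})$ is a manifold and a $\Gamma$-resolution of $\overline{\mathcal S}$ which coincides with $(Z,\phi)$: $$(Z,\phi)=\underline{\mathcal X}^{-1}\big((Z(\widehat R),\phi_{\widehat R})\big).$$ -/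

import Mathlib

open Set Filter Topology
open scoped Manifold ContDiff

/-! ## Groupoids, modules and bimodules: the algebraic layer

Arrows compose as in `g h` with `tgt g = src h`. The product `mul` and the actions `act` are total
functions; their values carry meaning only on composable pairs, and all laws and all smoothness
conditions are restricted to such pairs. -/

/-- A groupoid with set of arrows `G` and set of objects `M`. -/
structure SetGroupoid (G M : Type*) where
  src : G → M
  tgt : G → M
  unit : M → G
  inv : G → G
  mul : G → G → G
  src_unit : ∀ m, src (unit m) = m
  tgt_unit : ∀ m, tgt (unit m) = m
  src_mul : ∀ g h, tgt g = src h → src (mul g h) = src g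
  tgt_mul : ∀ g h, tgt g = src h → tgt (mul g h) = tgt h
  mul_assoc : ∀ g h k, tgt g = src h → tgt h = src k → mul (mul g h) k = mul g (mul h k)
  unit_mul : ∀ g, mul (unit (src g)) g = g
  mul_unit : ∀ g, mul g (unit (tgt g)) = g
  src_inv : ∀ g, src (inv g) = tgt g
  tgt_inv : ∀ g, tgt (inv g) = src g
  mul_inv : ∀ g, mul g (inv g) = unit (src g)
  inv_mul : ∀ g, mul (inv g) g = unit (tgt g)

namespace SetGroupoid

section Algebra

variable {G M G' M' X Z : Type*}

theorem eq_inv_of_mul (Γ : SetGroupoid G M) {g h : G} (hgh : Γ.tgt g = Γ.src h)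
    (h1 : Γ.mul g h = Γ.unit (Γ.src g)) : h = Γ.inv g := by
  have e1 : Γ.mul (Γ.mul (Γ.inv g) g) h = Γ.mul (Γ.inv g) (Γ.mul g h) :=
    Γ.mul_assoc _ _ _ (Γ.tgt_inv g) hgh
  rw [h1, Γ.inv_mul, hgh, Γ.unit_mul] at e1
  rw [e1, ← Γ.tgt_inv g, Γ.mul_unit]

theorem inv_unit (Γ : SetGroupoid G M) (m : M) : Γ.inv (Γ.unit m) = Γ.unit m := by
  symm
  apply Γ.eq_inv_of_mul
  · rw [Γ.src_unit, Γ.tgt_unit]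
  · have := Γ.unit_mul (Γ.unit m)
    rw [Γ.src_unit] at this ⊢
    exact this

theorem inv_mul_rev (Γ : SetGroupoid G M) {g h : G} (hgh : Γ.tgt g = Γ.src h) :
    Γ.inv (Γ.mul g h) = Γ.mul (Γ.inv h) (Γ.inv g) := by
  have hi : Γ.tgt (Γ.inv h) = Γ.src (Γ.inv g) := by rw [Γ.tgt_inv, Γ.src_inv, hgh]
  symm
  apply Γ.eq_inv_of_mul
  · rw [Γ.tgt_mul _ _ hgh, Γ.src_mul _ _ hi, Γ.src_inv]
  · rw [Γ.mul_assoc _ _ _ hgh (by rw [Γ.src_mul _ _ hi, Γ.src_inv]),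
      ← Γ.mul_assoc h _ _ (Γ.src_inv h).symm hi, Γ.mul_inv, ← hgh, ← Γ.src_inv g, Γ.unit_mul,
      Γ.mul_inv, Γ.src_mul _ _ hgh]

/-- A subset of the objects is stable if it is a union of orbits. -/
def IsStable (Γ : SetGroupoid G M) (S : Set M) : Prop :=
  ∀ g, Γ.tgt g ∈ S ↔ Γ.src g ∈ S

/-- The pair groupoid `Z × Z ⇉ Z`. -/
def pair (Z : Type*) : SetGroupoid (Z × Z) Z where
  src p := p.1
  tgt p := p.2
  unit z := (z, z)
  inv p := (p.2, p.1)
  mul p q := (p.1, q.2)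
  src_unit _ := rfl
  tgt_unit _ := rfl
  src_mul _ _ _ := rfl
  tgt_mul _ _ _ := rfl
  mul_assoc _ _ _ _ _ := rfl
  unit_mul _ := rfl
  mul_unit _ := rfl
  src_inv _ := rfl
  tgt_inv _ := rfl
  mul_inv _ := rfl
  inv_mul _ := rfl

/-- The direct product of two groupoids. -/
def prod (Γ : SetGroupoid G M) (Γ' : SetGroupoid G' M') : SetGroupoid (G × G') (M × M') where
  src g := (Γ.src g.1, Γ'.src g.2)
  tgt g := (Γ.tgt g.1, Γ'.tgt g.2)
  unit m := (Γ.unit m.1, Γ'.unit m.2)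
  inv g := (Γ.inv g.1, Γ'.inv g.2)
  mul g h := (Γ.mul g.1 h.1, Γ'.mul g.2 h.2)
  src_unit m := by simp [src_unit]
  tgt_unit m := by simp [tgt_unit]
  src_mul g h hgh := by
    rw [Prod.mk.injEq] at hgh ⊢
    exact ⟨Γ.src_mul _ _ hgh.1, Γ'.src_mul _ _ hgh.2⟩
  tgt_mul g h hgh := by
    rw [Prod.mk.injEq] at hgh ⊢
    exact ⟨Γ.tgt_mul _ _ hgh.1, Γ'.tgt_mul _ _ hgh.2⟩
  mul_assoc g h k hgh hhk := by
    rw [Prod.mk.injEq] at hgh hhk ⊢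
    exact ⟨Γ.mul_assoc _ _ _ hgh.1 hhk.1, Γ'.mul_assoc _ _ _ hgh.2 hhk.2⟩
  unit_mul g := by simp [unit_mul]
  mul_unit g := by simp [mul_unit]
  src_inv g := by simp [src_inv]
  tgt_inv g := by simp [tgt_inv]
  mul_inv g := by simp [mul_inv]
  inv_mul g := by simp [inv_mul]

/-- A left module: `g · x` makes sense when `tgt g = anchor x`. -/
structure LeftModule (Γ : SetGroupoid G M) (X : Type*) where
  anchor : X → M
  act : G → X → X
  anchor_act : ∀ g x, Γ.tgt g = anchor x → anchor (act g x) = Γ.src g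
  act_unit : ∀ x, act (Γ.unit (anchor x)) x = x
  act_mul : ∀ g h x, Γ.tgt g = Γ.src h → Γ.tgt h = anchor x →
    act (Γ.mul g h) x = act g (act h x)

/-- A right module: `x · g` makes sense when `anchor x = src g`. -/
structure RightModule (Γ : SetGroupoid G M) (X : Type*) where
  anchor : X → M
  act : X → G → X
  anchor_act : ∀ x g, anchor x = Γ.src g → anchor (act x g) = Γ.tgt g
  act_unit : ∀ x, act x (Γ.unit (anchor x)) = x
  act_mul : ∀ x g h, anchor x = Γ.src g → Γ.tgt g = Γ.src h →
    act x (Γ.mul g h) = act (act x g) h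

/-- A bimodule: a left and a right module structure on the same set, each of which preserves the
fibres of the other anchor, and which commute. `left.anchor` is `p`, `right.anchor` is `p'`. -/
structure Bimodule (Γ : SetGroupoid G M) (Γ' : SetGroupoid G' M') (X : Type*) where
  left : LeftModule Γ X
  right : RightModule Γ' X
  right_act_left : ∀ g x, Γ.tgt g = left.anchor x →
    right.anchor (left.act g x) = right.anchor x
  left_act_right : ∀ x g', right.anchor x = Γ'.src g' →
    left.anchor (right.act x g') = left.anchor x
  act_comm : ∀ g x g', Γ.tgt g = left.anchor x → right.anchor x = Γ'.src g' →
    right.act (left.act g x) g' = left.act g (right.act x g')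

namespace Bimodule

variable {Γ : SetGroupoid G M} {Γ' : SetGroupoid G' M'}

/-- The inverse bimodule: the same set, with `g' · x := x · g'⁻¹` and `x · g := g⁻¹ · x`. -/
def inverse (B : Bimodule Γ Γ' X) : Bimodule Γ' Γ X where
  left :=
    { anchor := B.right.anchor
      act := fun g' x => B.right.act x (Γ'.inv g')
      anchor_act := fun g' x h => by
        rw [B.right.anchor_act _ _ (by rw [Γ'.src_inv, h]), Γ'.tgt_inv]
      act_unit := fun x => by rw [Γ'.inv_unit, B.right.act_unit]
      act_mul := fun g h x hgh hx => by
        rw [Γ'.inv_mul_rev hgh]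
        exact B.right.act_mul _ _ _ (by rw [Γ'.src_inv, hx])
          (by rw [Γ'.tgt_inv, Γ'.src_inv, hgh]) }
  right :=
    { anchor := B.left.anchor
      act := fun x g => B.left.act (Γ.inv g) x
      anchor_act := fun x g h => by
        rw [B.left.anchor_act _ _ (by rw [Γ.tgt_inv, h]), Γ.src_inv]
      act_unit := fun x => by rw [Γ.inv_unit, B.left.act_unit]
      act_mul := fun x g h hx hgh => by
        rw [Γ.inv_mul_rev hgh]
        exact B.left.act_mul _ _ _ (by rw [Γ.tgt_inv, Γ.src_inv, hgh])
          (by rw [Γ.tgt_inv, hx]) }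
  right_act_left g' x h := B.left_act_right _ _ (by rw [Γ'.src_inv]; exact h.symm)
  left_act_right x g h := B.right_act_left _ _ (by rw [Γ.tgt_inv]; exact h.symm)
  act_comm g' x g h h' :=
    (B.act_comm _ _ _ (by rw [Γ.tgt_inv]; exact h'.symm) (by rw [Γ'.src_inv]; exact h.symm)).symm

/-- The correspondence of stable subsets `S ↦ p' (p ⁻¹ S)`. -/
def mapStable (B : Bimodule Γ Γ' X) (S : Set M) : Set M' :=
  B.right.anchor '' (B.left.anchor ⁻¹' S)

/-- The fibre product `Z ×_M X`. -/
def fibre (B : Bimodule Γ Γ' X) (N : RightModule Γ Z) : Set (Z × X) :=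
  {q | N.anchor q.1 = B.left.anchor q.2}

/-- The relation `(z, x) ∼ (z · g⁻¹, g · x)` on `Z ×_M X`. -/
def rel (B : Bimodule Γ Γ' X) (N : RightModule Γ Z) (q q' : B.fibre N) : Prop :=
  ∃ g, Γ.tgt g = N.anchor q.1.1 ∧ q'.1 = (N.act q.1.1 (Γ.inv g), B.left.act g q.1.2)

/-- The set `(Z ×_M X) / ∼`. -/
abbrev Induced (B : Bimodule Γ Γ' X) (N : RightModule Γ Z) : Type _ :=
  Quot (B.rel N)

open Classical in
/-- The right `Γ'`-module that corresponds to the right `Γ`-module `N`: the set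
`(Z ×_M X) / ∼` with `[z, x] ↦ p' x` and `[z, x] · g' = [z, x · g']`. -/
noncomputable def induced (B : Bimodule Γ Γ' X) (N : RightModule Γ Z) :
    RightModule Γ' (B.Induced N) where
  anchor := Quot.lift (fun q => B.right.anchor q.1.2) (by
    rintro q q' ⟨g, hg, hq'⟩
    show B.right.anchor q.1.2 = B.right.anchor q'.1.2
    rw [hq']
    exact (B.right_act_left g _ (hg.trans q.2)).symm)
  act w g' := Quot.lift (fun q : B.fibre N =>
      if h : B.right.anchor q.1.2 = Γ'.src g' then
        Quot.mk (B.rel N) ⟨(q.1.1, B.right.act q.1.2 g'),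
          (show N.anchor q.1.1 = _ from q.2).trans (B.left_act_right _ _ h).symm⟩
      else Quot.mk (B.rel N) q) (by
    rintro ⟨⟨z, x⟩, hq⟩ ⟨⟨z', x'⟩, hq'⟩ ⟨g, hg, e⟩
    obtain ⟨rfl, rfl⟩ := Prod.mk.injEq .. ▸ e
    have hgx : Γ.tgt g = B.left.anchor x := Eq.trans hg hq
    have ha := B.right_act_left g x hgx
    by_cases h : B.right.anchor x = Γ'.src g'
    · have h' := ha.trans h
      simp only [h, h', dif_pos]
      apply Quot.sound
      refine ⟨g, hg, ?_⟩
      show (_, B.right.act (B.left.act g x) g') = (_, B.left.act g (B.right.act x g'))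
      rw [B.act_comm g x g' hgx h]
    · have h' : ¬ B.right.anchor (B.left.act g x) = Γ'.src g' := fun h' => h (ha.symm.trans h')
      simp only [h, h', dif_neg, not_false_eq_true]
      exact Quot.sound ⟨g, hg, rfl⟩) w
  anchor_act := by
    rintro ⟨q⟩ g' h
    have h1 : B.right.anchor q.1.2 = Γ'.src g' := h
    simp only [h1, dif_pos]
    exact B.right.anchor_act _ _ h1
  act_unit := by
    rintro ⟨q⟩
    have h1 : B.right.anchor q.1.2 = Γ'.src (Γ'.unit (B.right.anchor q.1.2)) :=
      (Γ'.src_unit _).symm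
    simp only [← h1, dif_pos, B.right.act_unit]
  act_mul := by
    rintro ⟨q⟩ g h hg hgh
    have h1 : B.right.anchor q.1.2 = Γ'.src g := hg
    have h2 : B.right.anchor q.1.2 = Γ'.src (Γ'.mul g h) := by rw [h1, Γ'.src_mul _ _ hgh]
    have h3 : B.right.anchor (B.right.act q.1.2 g) = Γ'.src h := by
      rw [B.right.anchor_act _ _ h1, hgh]
    simp only [h1, h2.symm.trans h1, h3, dif_pos]
    congr 3
    exact B.right.act_mul _ _ _ h1 hgh

end Bimodule

/-- For subsets `R` of the arrows and `L` of the objects: the relation `γ ∼ r γ`, `r ∈ R`, on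
`Γ_L = src ⁻¹ L`. -/
def subRel (Γ : SetGroupoid G M) (R : Set G) (L : Set M) (a b : Γ.src ⁻¹' L) : Prop :=
  ∃ r ∈ R, Γ.tgt r = Γ.src a.1 ∧ b.1 = Γ.mul r a.1

/-- The set `Z(R) = R \ Γ_L`. -/
abbrev ZQuot (Γ : SetGroupoid G M) (R : Set G) (L : Set M) : Type _ :=
  Quot (Γ.subRel R L)

open Classical in
/-- The right module `(Z(R), φ_R)`: `φ_R [γ] = tgt γ` and `[γ] · g = [γ g]`. -/
noncomputable def ZModule (Γ : SetGroupoid G M) (R : Set G) (L : Set M) :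
    RightModule Γ (Γ.ZQuot R L) where
  anchor := Quot.lift (fun a => Γ.tgt a.1) (by
    rintro a b ⟨r, -, hr, hb⟩
    show Γ.tgt a.1 = Γ.tgt b.1
    rw [hb, Γ.tgt_mul _ _ hr])
  act w g := Quot.lift (fun a : Γ.src ⁻¹' L =>
      if h : Γ.tgt a.1 = Γ.src g then
        Quot.mk (Γ.subRel R L) ⟨Γ.mul a.1 g, by
          rw [mem_preimage, Γ.src_mul _ _ h]; exact a.2⟩
      else Quot.mk (Γ.subRel R L) a) (by
    rintro ⟨a, ha⟩ ⟨b, hb⟩ ⟨r, hrR, hr, hab⟩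
    obtain rfl : b = Γ.mul r a := hab
    have ht := Γ.tgt_mul r a hr
    by_cases h : Γ.tgt a = Γ.src g
    · have h' := ht.trans h
      simp only [h, h', dif_pos]
      apply Quot.sound
      refine ⟨r, hrR, ?_, ?_⟩
      · rw [Γ.src_mul _ _ h, hr]
      · exact Γ.mul_assoc _ _ _ hr h
    · have h' : ¬ Γ.tgt (Γ.mul r a) = Γ.src g := fun h' => h (ht.symm.trans h')
      simp only [h, h', dif_neg, not_false_eq_true]
      exact Quot.sound ⟨r, hrR, hr, rfl⟩) w
  anchor_act := by
    rintro ⟨a⟩ g h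
    have h1 : Γ.tgt a.1 = Γ.src g := h
    simp only [h1, dif_pos]
    exact Γ.tgt_mul _ _ h1
  act_unit := by
    rintro ⟨a⟩
    have h1 : Γ.tgt a.1 = Γ.src (Γ.unit (Γ.tgt a.1)) := (Γ.src_unit _).symm
    simp only [← h1, dif_pos, Γ.mul_unit]
  act_mul := by
    rintro ⟨a⟩ g h hg hgh
    have h1 : Γ.tgt a.1 = Γ.src g := hg
    have h2 : Γ.src (Γ.mul g h) = Γ.src g := Γ.src_mul _ _ hgh
    have h3 : Γ.tgt (Γ.mul a.1 g) = Γ.src h := by rw [Γ.tgt_mul _ _ h1, hgh]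
    simp only [h1, h2, h3, dif_pos]
    congr 2
    exact (Γ.mul_assoc _ _ _ h1 hgh).symm

/-- The natural bimodule between `Γ` and `Γ × (Z × Z ⇉ Z)`: the set `Γ × Z` with
`p (γ, z) = src γ`, `p' (γ, z) = (tgt γ, z)`, `g · (γ, z) = (g γ, z)` and
`(γ, z) · (g, (z, z')) = (γ g, z')`. -/
def naturalBimodule (Γ : SetGroupoid G M) (Z : Type*) :
    Bimodule Γ (Γ.prod (pair Z)) (G × Z) where
  left :=
    { anchor := fun x => Γ.src x.1
      act := fun g x => (Γ.mul g x.1, x.2)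
      anchor_act := fun g x h => Γ.src_mul _ _ h
      act_unit := fun x => by simp [Γ.unit_mul]
      act_mul := fun g h x hgh hx => by simp [Γ.mul_assoc _ _ _ hgh hx] }
  right :=
    { anchor := fun x => (Γ.tgt x.1, x.2)
      act := fun x g => (Γ.mul x.1 g.1, g.2.2)
      anchor_act := fun x g h => by
        have h1 : Γ.tgt x.1 = Γ.src g.1 := congrArg Prod.fst h
        simp [prod, pair, Γ.tgt_mul _ _ h1]
      act_unit := fun x => by simp [prod, pair, Γ.mul_unit]
      act_mul := fun x g h hx hgh => by
        have h1 : Γ.tgt x.1 = Γ.src g.1 := congrArg Prod.fst hx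
        have h2 : Γ.tgt g.1 = Γ.src h.1 := congrArg Prod.fst hgh
        simp [prod, pair, Γ.mul_assoc _ _ _ h1 h2] }
  right_act_left g x h := by simp [Γ.tgt_mul _ _ h]
  left_act_right x g h := Γ.src_mul _ _ (congrArg Prod.fst h)
  act_comm g x g' h h' := by
    have h1 : Γ.tgt x.1 = Γ.src g'.1 := congrArg Prod.fst h'
    simp [Γ.mul_assoc _ _ _ h h1]

/-- For a right `Γ`-module `(Z, φ)`: the right `Γ × (Z × Z ⇉ Z)`-module `(Z × Z, φ × id)` with
`(z, z₁) · (g, (z₁, z₂)) = (z · g, z₂)`. -/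
def RightModule.hat {Γ : SetGroupoid G M} (N : RightModule Γ Z) :
    RightModule (Γ.prod (pair Z)) (Z × Z) where
  anchor w := (N.anchor w.1, w.2)
  act w g := (N.act w.1 g.1, g.2.2)
  anchor_act w g h := by
    have h1 : N.anchor w.1 = Γ.src g.1 := congrArg Prod.fst h
    simp [prod, pair, N.anchor_act _ _ h1]
  act_unit w := by simp [prod, pair, N.act_unit]
  act_mul w g h hw hgh := by
    have h1 : N.anchor w.1 = Γ.src g.1 := congrArg Prod.fst hw
    have h2 : Γ.tgt g.1 = Γ.src h.1 := congrArg Prod.fst hgh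
    simp [prod, pair, N.act_mul _ _ _ h1 h2]

/-- For a right module `(Z, φ)` and a subset `Lt` of `Z` that `φ` maps bijectively onto `L`, with
inverse `ψ`: the set of all arrows `r` with `src r ∈ L` and `ψ (src r) · r ∈ Lt`. -/
def RightModule.arrowsOf {Γ : SetGroupoid G M} (N : RightModule Γ Z) (Lt : Set Z) : Set G :=
  {r | ∃ z ∈ Lt, N.anchor z = Γ.src r ∧ N.act z r ∈ Lt}

end Algebra

end SetGroupoid

/-! ## Submanifolds, as subsets

`𝕜` is `ℝ` or `ℂ`; manifolds are finite-dimensional and without boundary, and `C^∞` over `ℂ`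
means holomorphic. On an embedded submanifold `A`, `ContMDiffOn I J ∞ f A` says precisely
that the restriction of `f` to `A` is smooth. -/

section Submanifolds

variable {𝕜 : Type*} [RCLike 𝕜]
  {E H X : Type*} [NormedAddCommGroup E] [NormedSpace 𝕜 E] [TopologicalSpace H]
  [TopologicalSpace X] [ChartedSpace H X]
  {E' H' Y : Type*} [NormedAddCommGroup E'] [NormedSpace 𝕜 E'] [TopologicalSpace H']
  [TopologicalSpace Y] [ChartedSpace H' Y]

/-- `A` is an embedded submanifold (of some codimension `c`): locally the zero set of a submersion
to `𝕜 ^ c`. -/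
def IsEmbeddedSubmanifold (I : ModelWithCorners 𝕜 E H) (A : Set X) : Prop :=
  ∃ c : ℕ, ∀ x ∈ A, ∃ U : Set X, IsOpen U ∧ x ∈ U ∧ ∃ f : X → (Fin c → 𝕜),
    ContMDiffOn I 𝓘(𝕜, Fin c → 𝕜) ∞ f U ∧
    (∀ y ∈ U, Function.Surjective (mfderiv I 𝓘(𝕜, Fin c → 𝕜) f y)) ∧
    ∀ y ∈ U, y ∈ A ↔ f y = 0

/-- The tangent space at `x` of an embedded submanifold `A`: the velocities of all smooth paths in
`A` that start at `x`. -/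
def tangentVectors (I : ModelWithCorners 𝕜 E H) (A : Set X) (x : X) : Set (TangentSpace I x) :=
  {v | ∃ c : 𝕜 → X, c 0 = x ∧ ContMDiffAt 𝓘(𝕜, 𝕜) I ∞ c 0 ∧ (∀ᶠ τ in 𝓝 (0 : 𝕜), c τ ∈ A) ∧
    mfderiv 𝓘(𝕜, 𝕜) I c 0 (1 : 𝕜) = v}

/-- `f` restricts to a diffeomorphism (a biholomorphism) from `A` onto `B`. -/
def IsDiffeoOn (I : ModelWithCorners 𝕜 E H) (J : ModelWithCorners 𝕜 E' H') (f : X → Y)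
    (A : Set X) (B : Set Y) : Prop :=
  BijOn f A B ∧ ContMDiffOn I J ∞ f A ∧
    ∀ g : Y → X, LeftInvOn g f A → ContMDiffOn J I ∞ g B

/-- The quotient of the submanifold `P` of `X` by a relation, with the quotient topology and a
given atlas, is a (Hausdorff, second countable) manifold such that the projection is a
submersion: smooth, with smooth local sections through all points of `P`. These conditions
determine the manifold structure of the quotient. -/
structure IsQuotientManifold (I : ModelWithCorners 𝕜 E H) (J : ModelWithCorners 𝕜 E' H')
    (P : Set X) (r : P → P → Prop) [ChartedSpace H' (Quot r)] : Prop where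
  isManifold : IsManifold J ∞ (Quot r)
  t2 : T2Space (Quot r)
  secondCountable : SecondCountableTopology (Quot r)
  smooth : ∀ x : P, ∃ U : Set X, IsOpen U ∧ x.1 ∈ U ∧ ∃ f : X → Quot r,
    ContMDiffOn I J ∞ f U ∧ ∀ y : P, y.1 ∈ U → f y.1 = Quot.mk r y
  sections : ∀ x : P, ∃ V : Set (Quot r), IsOpen V ∧ Quot.mk r x ∈ V ∧ ∃ σ : Quot r → X,
    ContMDiffOn J I ∞ σ V ∧ σ (Quot.mk r x) = x.1 ∧
      ∀ w ∈ V, ∃ h : σ w ∈ P, Quot.mk r ⟨σ w, h⟩ = w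

/-- `(Z, φ)` is a resolution of the closure of the embedded submanifold `S`. -/
def IsResolution (I : ModelWithCorners 𝕜 E H) (J : ModelWithCorners 𝕜 E' H') (S : Set Y)
    (φ : X → Y) : Prop :=
  ContMDiff I J ∞ φ ∧ Dense (φ ⁻¹' S) ∧ IsDiffeoOn I J φ (φ ⁻¹' S) S

end Submanifolds

/-! ## Lie groupoids, equivariant resolutions, Morita equivalences, Lie subgroupoids -/

namespace SetGroupoid

section Smooth

variable {𝕜 : Type*} [RCLike 𝕜]
  {E₁ H₁ G : Type*} [NormedAddCommGroup E₁] [NormedSpace 𝕜 E₁] [TopologicalSpace H₁]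
  [TopologicalSpace G] [ChartedSpace H₁ G]
  {E₂ H₂ M : Type*} [NormedAddCommGroup E₂] [NormedSpace 𝕜 E₂] [TopologicalSpace H₂]
  [TopologicalSpace M] [ChartedSpace H₂ M]
  {E₃ H₃ Z : Type*} [NormedAddCommGroup E₃] [NormedSpace 𝕜 E₃] [TopologicalSpace H₃]
  [TopologicalSpace Z] [ChartedSpace H₃ Z]
  {E₄ H₄ G' : Type*} [NormedAddCommGroup E₄] [NormedSpace 𝕜 E₄] [TopologicalSpace H₄]
  [TopologicalSpace G'] [ChartedSpace H₄ G']
  {E₅ H₅ M' : Type*} [NormedAddCommGroup E₅] [NormedSpace 𝕜 E₅] [TopologicalSpace H₅]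
  [TopologicalSpace M'] [ChartedSpace H₅ M']

/-- `Γ ⇉ M` is a Lie groupoid for the given manifold structures on arrows and objects. -/
structure IsLie (Γ : SetGroupoid G M) (I : ModelWithCorners 𝕜 E₁ H₁)
    (J : ModelWithCorners 𝕜 E₂ H₂) : Prop where
  src : Manifold.IsSubmersion I J ∞ Γ.src
  tgt : Manifold.IsSubmersion I J ∞ Γ.tgt
  unit : ContMDiff J I ∞ Γ.unit
  inv : ContMDiff I I ∞ Γ.inv
  mul : ContMDiffOn (I.prod I) I ∞ (fun q : G × G => Γ.mul q.1 q.2)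
    {q | Γ.tgt q.1 = Γ.src q.2}

/-- The tangent space at `m` of the orbit through `m`: velocities at `m` of the paths
`τ ↦ tgt (c τ)`, for paths of arrows `c` with source `m` that start at the unit. -/
def orbitTangent (Γ : SetGroupoid G M) (I : ModelWithCorners 𝕜 E₁ H₁)
    (J : ModelWithCorners 𝕜 E₂ H₂) (m : M) : Set (TangentSpace J m) :=
  {v | ∃ c : 𝕜 → G, c 0 = Γ.unit m ∧ ContMDiffAt 𝓘(𝕜, 𝕜) I ∞ c 0 ∧
    (∀ᶠ τ in 𝓝 (0 : 𝕜), Γ.src (c τ) = m) ∧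
    mfderiv 𝓘(𝕜, 𝕜) J (fun τ => Γ.tgt (c τ)) 0 (1 : 𝕜) = v}

/-- The left action is smooth. -/
structure LeftModule.IsSmooth {Γ : SetGroupoid G M} (N : LeftModule Γ Z)
    (I : ModelWithCorners 𝕜 E₁ H₁) (J : ModelWithCorners 𝕜 E₂ H₂)
    (K : ModelWithCorners 𝕜 E₃ H₃) : Prop where
  anchor : ContMDiff K J ∞ N.anchor
  act : ContMDiffOn (I.prod K) K ∞ (fun q : G × Z => N.act q.1 q.2)
    {q | Γ.tgt q.1 = N.anchor q.2}

/-- The right action is smooth. -/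
structure RightModule.IsSmooth {Γ : SetGroupoid G M} (N : RightModule Γ Z)
    (I : ModelWithCorners 𝕜 E₁ H₁) (J : ModelWithCorners 𝕜 E₂ H₂)
    (K : ModelWithCorners 𝕜 E₃ H₃) : Prop where
  anchor : ContMDiff K J ∞ N.anchor
  act : ContMDiffOn (K.prod I) K ∞ (fun q : Z × G => N.act q.1 q.2)
    {q | N.anchor q.1 = Γ.src q.2}

/-- The tangent space at `z` of the `Γ`-orbit through `z` in a right module. -/
def RightModule.orbitTangent {Γ : SetGroupoid G M} (N : RightModule Γ Z)
    (I : ModelWithCorners 𝕜 E₁ H₁) (K : ModelWithCorners 𝕜 E₃ H₃) (z : Z) :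
    Set (TangentSpace K z) :=
  {v | ∃ c : 𝕜 → G, c 0 = Γ.unit (N.anchor z) ∧ ContMDiffAt 𝓘(𝕜, 𝕜) I ∞ c 0 ∧
    (∀ᶠ τ in 𝓝 (0 : 𝕜), Γ.src (c τ) = N.anchor z) ∧
    mfderiv 𝓘(𝕜, 𝕜) K (fun τ => N.act z (c τ)) 0 (1 : 𝕜) = v}

/-- `(Z, φ)`, with the given right action, is a `Γ`-resolution of the closure of `S`. -/
def RightModule.IsEquivariantResolution {Γ : SetGroupoid G M} (N : RightModule Γ Z)
    (I : ModelWithCorners 𝕜 E₁ H₁) (J : ModelWithCorners 𝕜 E₂ H₂)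
    (K : ModelWithCorners 𝕜 E₃ H₃) (S : Set M) : Prop :=
  N.IsSmooth I J K ∧ IsResolution K J S N.anchor

/-- Two right modules (in particular two `Γ`-resolutions) coincide: there is an equivariant
diffeomorphism over `M` between them. -/
def RightModule.Coincide {Γ : SetGroupoid G M} (N : RightModule Γ Z)
    (K : ModelWithCorners 𝕜 E₃ H₃) {E₆ H₆ W : Type*} [NormedAddCommGroup E₆] [NormedSpace 𝕜 E₆]
    [TopologicalSpace H₆] [TopologicalSpace W] [ChartedSpace H₆ W] (N' : RightModule Γ W)
    (K' : ModelWithCorners 𝕜 E₆ H₆) : Prop :=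
  ∃ Φ : Diffeomorph K K' Z W ∞, (∀ z, N'.anchor (Φ z) = N.anchor z) ∧
    ∀ z g, N.anchor z = Γ.src g → Φ (N.act z g) = N'.act (Φ z) g

/-- The bimodule `B` is a Morita equivalence of Lie groupoids. -/
structure Bimodule.IsMorita {Γ : SetGroupoid G M} {Γ' : SetGroupoid G' M'} (B : Bimodule Γ Γ' Z)
    (I : ModelWithCorners 𝕜 E₁ H₁) (J : ModelWithCorners 𝕜 E₂ H₂) (I' : ModelWithCorners 𝕜 E₄ H₄)
    (J' : ModelWithCorners 𝕜 E₅ H₅) (K : ModelWithCorners 𝕜 E₃ H₃) : Prop where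
  smooth_left : B.left.IsSmooth I J K
  smooth_right : B.right.IsSmooth I' J' K
  surjective_left : Function.Surjective B.left.anchor
  submersion_left : Manifold.IsSubmersion K J ∞ B.left.anchor
  surjective_right : Function.Surjective B.right.anchor
  submersion_right : Manifold.IsSubmersion K J' ∞ B.right.anchor
  free_left : ∀ g h x, Γ.tgt g = B.left.anchor x → Γ.tgt h = B.left.anchor x →
    B.left.act g x = B.left.act h x → g = h
  free_right : ∀ x g h, B.right.anchor x = Γ'.src g → B.right.anchor x = Γ'.src h →
    B.right.act x g = B.right.act x h → g = h
  transitive_left : ∀ x y, B.right.anchor x = B.right.anchor y →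
    ∃ g, Γ.tgt g = B.left.anchor x ∧ B.left.act g x = y
  transitive_right : ∀ x y, B.left.anchor x = B.left.anchor y →
    ∃ g, B.right.anchor x = Γ'.src g ∧ B.right.act x g = y
  proper_left : IsProperMap (fun q : {q : G × Z // Γ.tgt q.1 = B.left.anchor q.2} =>
    (B.left.act q.1.1 q.1.2, q.1.2))
  proper_right : IsProperMap (fun q : {q : Z × G' // B.right.anchor q.1 = Γ'.src q.2} =>
    (q.1.1, B.right.act q.1.1 q.1.2))

/-- `R ⇉ L` is a Lie subgroupoid of `Γ ⇉ M`: `L` and `R` are submanifolds that are stable under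
the structural maps, and the source map of `R` is a submersion onto `L`. -/
structure IsLieSubgroupoid (Γ : SetGroupoid G M) (I : ModelWithCorners 𝕜 E₁ H₁)
    (J : ModelWithCorners 𝕜 E₂ H₂) (R : Set G) (L : Set M) : Prop where
  objects : IsEmbeddedSubmanifold J L
  arrows : IsEmbeddedSubmanifold I R
  src_mem : ∀ r ∈ R, Γ.src r ∈ L
  tgt_mem : ∀ r ∈ R, Γ.tgt r ∈ L
  unit_mem : ∀ m ∈ L, Γ.unit m ∈ R
  inv_mem : ∀ r ∈ R, Γ.inv r ∈ R
  mul_mem : ∀ r ∈ R, ∀ r' ∈ R, Γ.tgt r = Γ.src r' → Γ.mul r r' ∈ R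
  submersion : ∀ r ∈ R, ∀ v ∈ tangentVectors J L (Γ.src r),
    ∃ u ∈ tangentVectors I R r, mfderiv I J Γ.src r u = v

/-- `R` is closed in the set `Γ_L^L` of all arrows with source and target in `L`. -/
def IsClosedIn (Γ : SetGroupoid G M) (R : Set G) (L : Set M) : Prop :=
  ∃ C : Set G, IsClosed C ∧ R = C ∩ (Γ.src ⁻¹' L ∩ Γ.tgt ⁻¹' L)

/-- `R ⇉ L` is a Lie subgroupoid in `S`: `L ∩ S` is dense in `L`, and `L` meets all orbits contained
in `S` and intersects them transversally. -/
structure IsSubgroupoidIn (Γ : SetGroupoid G M) (I : ModelWithCorners 𝕜 E₁ H₁)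
    (J : ModelWithCorners 𝕜 E₂ H₂) (R : Set G) (L S : Set M) : Prop where
  isLieSubgroupoid : Γ.IsLieSubgroupoid I J R L
  dense : L ⊆ closure (L ∩ S)
  transverse : ∀ m ∈ L ∩ S, ∀ v : TangentSpace J m, v ∈ tangentVectors J S m ↔
    ∃ a ∈ Γ.orbitTangent I J m, ∃ b ∈ tangentVectors J L m, v = a + b
  meets : ∀ m ∈ S, ∃ g, Γ.src g = m ∧ Γ.tgt g ∈ L

/-- `R ⇉ L` is a Lie subgroupoid full in `S`: it is in `S`, and an arrow of `Γ` that connects two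
points of `L ∩ S` belongs to `R`. -/
structure IsFullSubgroupoidIn (Γ : SetGroupoid G M) (I : ModelWithCorners 𝕜 E₁ H₁)
    (J : ModelWithCorners 𝕜 E₂ H₂) (R : Set G) (L S : Set M) : Prop where
  isSubgroupoidIn : Γ.IsSubgroupoidIn I J R L S
  full : ∀ g, Γ.src g ∈ L ∩ S → Γ.tgt g ∈ L ∩ S → g ∈ R

/-- The submanifold `Lt` of `Z` exhibits the `Γ`-resolution `(Z, φ)` of the closure of `S` as
`L`-compatible: `L` is a submanifold in which `L ∩ S` is dense, `φ` restricts to a diffeomorphism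
from `Lt` onto `L`, and `Lt` is transverse to the orbits of `Γ` in `Z` and meets all those
contained in `φ ⁻¹ S`. -/
structure RightModule.IsCompatibleVia {Γ : SetGroupoid G M} (N : RightModule Γ Z)
    (I : ModelWithCorners 𝕜 E₁ H₁) (J : ModelWithCorners 𝕜 E₂ H₂)
    (K : ModelWithCorners 𝕜 E₃ H₃) (S L : Set M) (Lt : Set Z) : Prop where
  submanifold : IsEmbeddedSubmanifold J L
  dense : L ⊆ closure (L ∩ S)
  submanifold_lift : IsEmbeddedSubmanifold K Lt
  diffeo : IsDiffeoOn K J N.anchor Lt L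
  transverse : ∀ z ∈ Lt, ∀ v : TangentSpace K z,
    ∃ a ∈ N.orbitTangent I K z, ∃ b ∈ tangentVectors K Lt z, v = a + b
  meets : ∀ z, N.anchor z ∈ S → ∃ g, N.anchor z = Γ.src g ∧ N.act z g ∈ Lt

end Smooth

end SetGroupoid

/-! The map `φ` need not be injective or an immersion, but `z ↦ (φ z, z)` is always an embedding.
Taking the product with the pair groupoid of `Z` replaces `Γ` by a Morita equivalent groupoid whose
objects have room for this graph. There `(Z, φ)` becomes `(Z × Z, φ × id)`, and the diagonal maps
diffeomorphically onto the graph `L`. Since `(z, z) · (γ, (z, y)) = (z · γ, y)`, the set `R`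
consists of the triples `(γ, (z, y))` with `y = z · γ`: it is a copy of the action groupoid of `Γ`
on `Z`.

`R` is a submanifold because its two equations `φ z = s γ` and `y = z · γ` are independent: `s` is a
submersion and `y` is a free coordinate. It is full because `φ` is injective over `S`.
Transversality holds because the orbits contain the pair groupoid direction: `(dφ u, v) = (0, v - u)
+ (dφ u, u)`. That such vectors are tangent to `S × Z` uses that `φ ⁻¹ S`, being dense and locally
closed, is open.

Each of the three quotients is the space of fibres of an explicit map: `(z, (γ, w)) ↦ (z · γ, w)`
for `X (Z, φ)`, `(γ, (z, w)) ↦ (z · γ, w)` for `Z(R)`, and `((z, w), (γ, w)) ↦ z · γ⁻¹` for `X⁻¹`,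
up to the identification of `Z(R)` with `Z × Z`. By `exists_isQuotientManifold` it suffices that
these maps have smooth local extensions and smooth local sections. The action is meaningful only on
a fibre product; `RightModule.IsSmooth.exists_extension` extends it by means of smooth retractions
onto the fibres of `s` (`Manifold.IsSubmersionAt.exists_retraction`). The sections come from local
sections of `s` and `t`. Tangent vectors are velocities of paths throughout, so the statements about
derivatives reduce to the construction of paths. -/

/-! ## Transport of manifold structures along homeomorphisms -/

section Transport

variable {𝕜 : Type*} [RCLike 𝕜]
  {E H W Q : Type*} [NormedAddCommGroup E] [NormedSpace 𝕜 E] [TopologicalSpace H]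
  [TopologicalSpace W] [ChartedSpace H W] [TopologicalSpace Q]

/-- The atlas on `Q` pulled back along a homeomorphism `e : Q ≃ₜ W`. -/
@[reducible]
def Homeomorph.pullbackChartedSpace (e : Q ≃ₜ W) (H : Type*) [TopologicalSpace H]
    [ChartedSpace H W] : ChartedSpace H Q where
  atlas := {c | ∃ d ∈ atlas H W, c = e.toOpenPartialHomeomorph.trans d}
  chartAt q := e.toOpenPartialHomeomorph.trans (chartAt H (e q))
  mem_chart_source q := by simp
  chart_mem_atlas q := ⟨_, chart_mem_atlas H (e q), rfl⟩

/-- In a change of charts `e⁻¹` and `e` cancel, so the transition maps are those of `W`. -/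
theorem Homeomorph.isManifold_pullback (e : Q ≃ₜ W) (J : ModelWithCorners 𝕜 E H)
    [IsManifold J ∞ W] : @IsManifold 𝕜 _ E _ _ H _ J ∞ Q _ (e.pullbackChartedSpace H) := by
  let _ := e.pullbackChartedSpace H
  have : HasGroupoid Q (contDiffGroupoid ∞ J) := ⟨by
    rintro _ _ ⟨c, hc, rfl⟩ ⟨d, hd, rfl⟩
    have h : (e.toOpenPartialHomeomorph.trans c).symm.trans (e.toOpenPartialHomeomorph.trans d)
        = c.symm.trans d := by
      rw [OpenPartialHomeomorph.trans_symm_eq_symm_trans_symm, OpenPartialHomeomorph.trans_assoc,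
        ← OpenPartialHomeomorph.trans_assoc _ _ d, ← Homeomorph.symm_toOpenPartialHomeomorph,
        ← Homeomorph.trans_toOpenPartialHomeomorph, Homeomorph.symm_trans_self,
        Homeomorph.refl_toOpenPartialHomeomorph, OpenPartialHomeomorph.refl_trans]
    rw [h]
    exact (contDiffGroupoid ∞ J).compatible hc hd⟩
  exact .mk' _ _ _

/-- A homeomorphism is a diffeomorphism for the atlas pulled back along it. -/
def Homeomorph.pullbackDiffeomorph (e : Q ≃ₜ W) (J : ModelWithCorners 𝕜 E H)
    [IsManifold J ∞ W] :
    @Diffeomorph 𝕜 _ E _ _ E _ _ H _ H _ J J Q _ (e.pullbackChartedSpace H) W _ _ ∞ :=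
  let _ := e.pullbackChartedSpace H
  have := e.isManifold_pullback J
  { toEquiv := e.toEquiv
    contMDiff_toFun := fun q => by
      have h1 : ContMDiffAt J J ∞ (chartAt H q) q :=
        (contMDiffOn_chart (I := J) (x := q)).contMDiffAt (chart_source_mem_nhds H q)
      have h2 : ContMDiffAt J J ∞ (chartAt H (e q)).symm (chartAt H q q) :=
        (contMDiffOn_chart_symm (I := J) (x := e q)).contMDiffAt
          (chart_target_mem_nhds H (e q))
      refine (h2.comp q h1).congr_of_eventuallyEq ?_
      filter_upwards [chart_source_mem_nhds H q] with y hy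
      have hy' : e y ∈ (chartAt H (e q)).source := hy.2
      exact ((chartAt H (e q)).left_inv hy').symm
    contMDiff_invFun := fun w => by
      have h1 : ContMDiffAt J J ∞ (chartAt H w) w :=
        (contMDiffOn_chart (I := J) (x := w)).contMDiffAt (chart_source_mem_nhds H w)
      -- The chart of `Q` at `e.symm w` is `e` followed by the chart of `W` at `e (e.symm w) = w`;
      -- read in these charts, `e.symm` is the identity.
      have ht : chartAt H w w ∈ (chartAt H (e.symm w)).target := by
        have h : chartAt H (e.symm w) (e.symm w) = chartAt H w w := by
          change chartAt H (e (e.symm w)) (e (e.symm w)) = _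
          rw [e.apply_symm_apply]
        rw [← h]
        exact mem_chart_target H (e.symm w)
      have h2 : ContMDiffAt J J ∞ (chartAt H (e.symm w)).symm (chartAt H w w) :=
        (contMDiffOn_chart_symm (I := J) (x := e.symm w)).contMDiffAt
          ((chartAt H (e.symm w)).open_target.mem_nhds ht)
      refine (h2.comp w h1).congr_of_eventuallyEq ?_
      filter_upwards [chart_source_mem_nhds H w] with y hy
      have h3 : (chartAt H (e.symm w)).symm (chartAt H w y)
          = e.symm ((chartAt H w).symm (chartAt H w y)) := by
        change e.symm ((chartAt H (e (e.symm w))).symm _) = _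
        rw [e.apply_symm_apply]
      change e.symm y = (chartAt H (e.symm w)).symm (chartAt H w y)
      rw [h3, (chartAt H w).left_inv hy] }

end Transport

/-! ## Quotients that are identified with a manifold -/

section Quotient

variable {𝕜 : Type*} [RCLike 𝕜]
  {E H X : Type*} [NormedAddCommGroup E] [NormedSpace 𝕜 E] [TopologicalSpace H]
  [TopologicalSpace X] [ChartedSpace H X]
  {E' H' W : Type*} [NormedAddCommGroup E'] [NormedSpace 𝕜 E'] [TopologicalSpace H']
  [TopologicalSpace W] [ChartedSpace H' W]

/-- A map `q` on a subset `P` that has local smooth extensions and local smooth sections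
identifies the quotient of `P` by the fibres of `q` with the target of `q`. -/
theorem exists_isQuotientManifold (I : ModelWithCorners 𝕜 E H) (J : ModelWithCorners 𝕜 E' H')
    [IsManifold J ∞ W] [T2Space W] [SecondCountableTopology W]
    {P : Set X} {r : P → P → Prop} (q : P → W)
    (hr : ∀ a b, r a b → q a = q b) (hq : ∀ a b, q a = q b → r a b)
    (hsurj : Function.Surjective q)
    (hsmooth : ∀ x : P, ∃ U : Set X, IsOpen U ∧ x.1 ∈ U ∧ ∃ f : X → W,
      ContMDiffOn I J ∞ f U ∧ ∀ y : P, y.1 ∈ U → f y.1 = q y)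
    (hsec : ∀ x : P, ∃ V : Set W, IsOpen V ∧ q x ∈ V ∧ ∃ σ : W → X,
      ContMDiffOn J I ∞ σ V ∧ σ (q x) = x.1 ∧ ∀ w ∈ V, ∃ h : σ w ∈ P, q ⟨σ w, h⟩ = w) :
    ∃ _ : ChartedSpace H' (Quot r), IsQuotientManifold I J P r ∧
      ∃ Φ : Diffeomorph J J (Quot r) W ∞, ∀ x, Φ (Quot.mk r x) = q x := by
  -- Continuity is local, and near each point `q` is the restriction of a smooth map.
  have hqc : Continuous q := continuous_iff_continuousAt.2 fun x => by
    obtain ⟨U, hU, hx, f, hf, hfq⟩ := hsmooth x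
    have h1 : ContinuousAt (fun y : P => f y.1) x :=
      (hf.continuousOn.continuousAt (hU.mem_nhds hx)).comp continuous_subtype_val.continuousAt
    refine h1.congr ?_
    filter_upwards [(hU.preimage continuous_subtype_val).mem_nhds hx] with y hy
    exact hfq y hy
  let e₀ : Quot r ≃ W := Equiv.ofBijective (Quot.lift q hr) ⟨by
    rintro ⟨a⟩ ⟨b⟩ h
    exact Quot.sound (hq a b h), fun w => by
    obtain ⟨x, hx⟩ := hsurj w
    exact ⟨Quot.mk r x, hx⟩⟩
  have he₀ : ∀ x, e₀ (Quot.mk r x) = q x := fun _ => rfl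
  -- Locally the inverse bijection is a section followed by the projection to the quotient. Hence
  -- the quotient topology is the topology of `W`, and the atlas of `W` can be pulled back.
  have hinv : Continuous e₀.symm := continuous_iff_continuousAt.2 fun w => by
    obtain ⟨x, rfl⟩ := hsurj w
    obtain ⟨V, hV, hx, σ, hσ, -, hσq⟩ := hsec x
    have hσP : ∀ w : V, σ w.1 ∈ P := fun w => (hσq w.1 w.2).1
    have h1 : Continuous fun w : V => (⟨σ w.1, hσP w⟩ : P) :=
      (continuousOn_iff_continuous_domRestrict.1 hσ.continuousOn).subtype_mk _
    have h2 : Continuous (V.domRestrict e₀.symm) := by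
      refine (continuous_quot_mk.comp h1).congr fun w => ?_
      rw [domRestrict_apply, Equiv.eq_symm_apply]
      exact (hσq w.1 w.2).2
    exact (continuousOn_iff_continuous_domRestrict.2 h2).continuousAt (hV.mem_nhds hx)
  let e : Quot r ≃ₜ W :=
    { toEquiv := e₀
      continuous_toFun := continuous_quot_lift hr hqc
      continuous_invFun := hinv }
  have he : ∀ x, e (Quot.mk r x) = q x := fun _ => rfl
  let _ := e.pullbackChartedSpace H'
  have hman := e.isManifold_pullback J
  let Φ := e.pullbackDiffeomorph J
  have hΦ : ∀ x, Φ x = e x := fun _ => rfl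
  have hΦs : ∀ x, Φ.symm (q x) = Quot.mk r x := fun x => by
    rw [← he x, ← hΦ, Φ.symm_apply_apply]
  refine ⟨_, ⟨hman, e.isEmbedding.t2Space, e.isEmbedding.secondCountableTopology, ?_, ?_⟩,
    Φ, he⟩
  · intro x
    obtain ⟨U, hU, hx, f, hf, hfq⟩ := hsmooth x
    refine ⟨U, hU, hx, Φ.symm ∘ f, Φ.symm.contMDiff.comp_contMDiffOn hf, fun y hy => ?_⟩
    rw [Function.comp_apply, hfq y hy, hΦs]
  · intro x
    obtain ⟨V, hV, hx, σ, hσ, hσx, hσq⟩ := hsec x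
    refine ⟨e ⁻¹' V, hV.preimage e.continuous, hx, σ ∘ Φ,
      hσ.comp Φ.contMDiff.contMDiffOn fun w hw => hw, hσx, fun w hw => ?_⟩
    obtain ⟨h, h'⟩ := hσq (e w) hw
    exact ⟨h, e.injective h'⟩

end Quotient

/-! ## Submersions -/

section Submersion

variable {𝕜 : Type*} [RCLike 𝕜]
  {E H X : Type*} [NormedAddCommGroup E] [NormedSpace 𝕜 E] [TopologicalSpace H]
  [TopologicalSpace X] [ChartedSpace H X]
  {E' H' Y : Type*} [NormedAddCommGroup E'] [NormedSpace 𝕜 E'] [TopologicalSpace H']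
  [TopologicalSpace Y] [ChartedSpace H' Y]
  {E'' H'' Z : Type*} [NormedAddCommGroup E''] [NormedSpace 𝕜 E''] [TopologicalSpace H'']
  [TopologicalSpace Z] [ChartedSpace H'' Z]
  {I : ModelWithCorners 𝕜 E H} {J : ModelWithCorners 𝕜 E' H'} {K : ModelWithCorners 𝕜 E'' H''}

/-- Near a point, a submersion `f` has a smooth family of retractions `ρ (y, ·)` onto its
fibres `f ⁻¹ y`. -/
theorem Manifold.IsSubmersionAt.exists_retraction [I.Boundaryless] [IsManifold I ∞ X]
    [IsManifold J ∞ Y] {f : X → Y} {x₀ : X}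
    (hf : Manifold.IsSubmersionAt I J ∞ f x₀) :
    ∃ W : Set (Y × X), IsOpen W ∧ (f x₀, x₀) ∈ W ∧ ∃ ρ : Y × X → X,
      ContMDiffOn (J.prod I) I ∞ ρ W ∧ (∀ p ∈ W, f (ρ p) = p.1) ∧
      ∀ x, (f x, x) ∈ W → ρ (f x, x) = x := by
  let a := hf.domChart.extend I
  let b := hf.codChart.extend J
  -- In adapted charts `f` is the projection to the first factor of `E' × complement`. The
  -- retraction keeps the complementary coordinate of `x` and replaces the first coordinate by that
  -- of `y`.
  let θ : Y × X → E := fun p => hf.equiv.symm (b p.1, (hf.equiv (a p.2)).2)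
  have hfa : ∀ x ∈ hf.domChart.source, b (f x) = (hf.equiv (a x)).1 := fun x hx => by
    have hx' : x ∈ a.source := by rwa [hf.domChart.extend_source]
    have := hf.writtenInCharts (a.map_source hx')
    simp only [Function.comp_apply] at this
    rwa [a.left_inv hx'] at this
  have hb : ContMDiffOn J 𝓘(𝕜, E') ∞ b hf.codChart.source :=
    OpenPartialHomeomorph.contMDiffOn_extend hf.codChart_mem_maximalAtlas
  have ha : ContMDiffOn I 𝓘(𝕜, E) ∞ a hf.domChart.source :=
    OpenPartialHomeomorph.contMDiffOn_extend hf.domChart_mem_maximalAtlas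
  have has : ContMDiffOn 𝓘(𝕜, E) I ∞ a.symm a.target := by
    have := contMDiffOn_extend_symm (I := I) hf.domChart_mem_maximalAtlas
    rwa [← OpenPartialHomeomorph.extend_target'] at this
  have hO : IsOpen (hf.codChart.source ×ˢ hf.domChart.source) :=
    hf.codChart.open_source.prod hf.domChart.open_source
  have hθ : ContMDiffOn (J.prod I) 𝓘(𝕜, E) ∞ θ (hf.codChart.source ×ˢ hf.domChart.source) := by
    have h1 : ContMDiffOn (J.prod I) 𝓘(𝕜, E') ∞ (fun p : Y × X => b p.1)
        (hf.codChart.source ×ˢ hf.domChart.source) :=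
      hb.comp contMDiff_fst.contMDiffOn fun p hp => hp.1
    have h2 : ContMDiffOn (J.prod I) 𝓘(𝕜, E) ∞ (fun p : Y × X => a p.2)
        (hf.codChart.source ×ˢ hf.domChart.source) :=
      ha.comp contMDiff_snd.contMDiffOn fun p hp => hp.2
    have h3 : ContMDiff 𝓘(𝕜, E) 𝓘(𝕜, hf.complement) ∞ fun u => (hf.equiv u).2 :=
      ((ContinuousLinearMap.snd 𝕜 E' hf.complement).comp
        (hf.equiv : E →L[𝕜] E' × hf.complement)).contMDiff
    exact (hf.equiv.symm : E' × hf.complement →L[𝕜] E).contMDiff.comp_contMDiffOn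
      (h1.prodMk_space (h3.comp_contMDiffOn h2))
  have hθf : ∀ x ∈ hf.domChart.source, θ (f x, x) = a x := fun x hx => by
    simp only [θ]
    rw [hfa x hx, Prod.mk.eta, ContinuousLinearEquiv.symm_apply_apply]
  have hsrc : ∀ x ∈ hf.domChart.source, x ∈ a.source := fun x hx => by
    rwa [hf.domChart.extend_source]
  -- The altered coordinates must stay in the target of the chart, so that they are the coordinates
  -- of a point of `X`.
  refine ⟨(hf.codChart.source ×ˢ hf.domChart.source) ∩ θ ⁻¹' a.target,
    hθ.continuousOn.isOpen_inter_preimage hO hf.domChart.isOpen_extend_target,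
    ⟨⟨hf.mem_codChart_source, hf.mem_domChart_source⟩, ?_⟩, fun p => a.symm (θ p),
    has.comp (hθ.mono inter_subset_left) fun p hp => hp.2, ?_, ?_⟩
  · rw [mem_preimage, hθf _ hf.mem_domChart_source]
    exact a.map_source (hsrc _ hf.mem_domChart_source)
  · rintro ⟨y, x⟩ ⟨⟨hy, -⟩, hu⟩
    have h1 : a.symm (θ (y, x)) ∈ hf.domChart.source := by
      rw [← hf.domChart.extend_source (I := I)]
      exact a.map_target hu
    have h2 := hf.source_subset_preimage_source h1
    have h3 := hfa _ h1
    rw [a.right_inv hu, ContinuousLinearEquiv.apply_symm_apply] at h3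
    exact b.injOn (by rw [hf.codChart.extend_source]; exact h2)
      (by rw [hf.codChart.extend_source]; exact hy) h3
  · rintro x ⟨⟨-, hx⟩, -⟩
    change a.symm (θ (f x, x)) = x
    rw [hθf x hx, a.left_inv (hsrc x hx)]

/-- Through every point of a submersion passes a smooth local section. -/
theorem Manifold.IsSubmersionAt.exists_section [I.Boundaryless] [IsManifold I ∞ X]
    [IsManifold J ∞ Y] {f : X → Y} {x₀ : X}
    (hf : Manifold.IsSubmersionAt I J ∞ f x₀) :
    ∃ V : Set Y, IsOpen V ∧ f x₀ ∈ V ∧ ∃ σ : Y → X, ContMDiffOn J I ∞ σ V ∧ σ (f x₀) = x₀ ∧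
      ∀ y ∈ V, f (σ y) = y := by
  obtain ⟨W, hW, hx, ρ, hρ, h1, h2⟩ := hf.exists_retraction
  have hm : ContMDiff J (J.prod I) ∞ fun y : Y => (y, x₀) := contMDiff_id.prodMk contMDiff_const
  exact ⟨{y | (y, x₀) ∈ W}, hW.preimage hm.continuous, hx, fun y => ρ (y, x₀),
    hρ.comp hm.contMDiffOn fun y hy => hy, h2 _ hx, fun y hy => h1 _ hy⟩

/-- In a product chart the normal form of `f` persists, with the coordinates of `Z` added to the
complement. -/
theorem Manifold.IsSubmersion.comp_fst [IsManifold I ∞ X] [IsManifold K ∞ Z]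
    {f : X → Y} (hf : Manifold.IsSubmersion I J ∞ f) :
    Manifold.IsSubmersion (I.prod K) J ∞ (fun p : X × Z => f p.1) := by
  refine Manifold.IsSubmersionOfComplement.isSubmersion (F := hf.complement × E'') fun p => ?_
  have h := hf.isSubmersionOfComplement_complement p.1
  refine Manifold.IsSubmersionAtOfComplement.mk_of_charts
    ((h.equiv.prodCongr (.refl 𝕜 E'')).trans (.prodAssoc 𝕜 E' hf.complement E''))
    (h.domChart.prod (chartAt H'' p.2)) h.codChart ⟨h.mem_domChart_source, mem_chart_source H'' _⟩
    h.mem_codChart_source ?_ h.codChart_mem_maximalAtlas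
    (fun x hx => h.source_subset_preimage_source hx.1) ?_
  · exact IsManifold.mem_maximalAtlas_prod h.domChart_mem_maximalAtlas
      (IsManifold.chart_mem_maximalAtlas _)
  · rw [OpenPartialHomeomorph.extend_prod, PartialEquiv.prod_target]
    rintro ⟨u, v⟩ ⟨hu, -⟩
    exact h.writtenInCharts hu

theorem Manifold.isSubmersion_snd [IsManifold I ∞ X] [IsManifold K ∞ Z] :
    Manifold.IsSubmersion (K.prod I) I ∞ (Prod.snd : Z × X → X) := by
  refine Manifold.IsSubmersionOfComplement.isSubmersion (F := E'') fun p => ?_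
  refine Manifold.IsSubmersionAtOfComplement.mk_of_charts (.prodComm 𝕜 E'' E)
    ((chartAt H'' p.1).prod (chartAt H p.2)) (chartAt H p.2)
    ⟨mem_chart_source H'' _, mem_chart_source H _⟩ (mem_chart_source H _) ?_
    (IsManifold.chart_mem_maximalAtlas _) (fun x hx => hx.2) ?_
  · exact IsManifold.mem_maximalAtlas_prod (IsManifold.chart_mem_maximalAtlas _)
      (IsManifold.chart_mem_maximalAtlas _)
  · rw [OpenPartialHomeomorph.extend_prod, PartialEquiv.prod_target]
    rintro ⟨u, v⟩ ⟨-, hv⟩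
    exact ((chartAt H p.2).extend I).right_inv hv

end Submersion

/-! ## Paths, tangent vectors and embedded submanifolds -/

section Paths

variable {𝕜 : Type*} [RCLike 𝕜]
  {E H X : Type*} [NormedAddCommGroup E] [NormedSpace 𝕜 E] [TopologicalSpace H]
  [TopologicalSpace X] [ChartedSpace H X]
  {E' H' Y : Type*} [NormedAddCommGroup E'] [NormedSpace 𝕜 E'] [TopologicalSpace H']
  [TopologicalSpace Y] [ChartedSpace H' Y]
  {F : Type*} [NormedAddCommGroup F] [NormedSpace 𝕜 F]
  {I : ModelWithCorners 𝕜 E H} {J : ModelWithCorners 𝕜 E' H'}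

/-- A path in the model space lifts to the manifold through a chart. -/
theorem contMDiffAt_extChartAt_symm_comp [I.Boundaryless] [IsManifold I ∞ X] {x₀ x : X}
    (hx : x ∈ (extChartAt I x₀).source) {u : 𝕜 → E} (hu : ContMDiffAt 𝓘(𝕜, 𝕜) 𝓘(𝕜, E) ∞ u 0)
    (hu0 : u 0 = extChartAt I x₀ x) :
    (extChartAt I x₀).symm (u 0) = x ∧
      ContMDiffAt 𝓘(𝕜, 𝕜) I ∞ (fun τ => (extChartAt I x₀).symm (u τ)) 0 ∧
      ∀ᶠ τ in 𝓝 (0 : 𝕜), (extChartAt I x₀).symm (u τ) ∈ (extChartAt I x₀).source ∧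
        extChartAt I x₀ ((extChartAt I x₀).symm (u τ)) = u τ := by
  have ht : (extChartAt I x₀).target ∈ 𝓝 (u 0) := by
    rw [hu0]
    exact (isOpen_extChartAt_target x₀).mem_nhds ((extChartAt I x₀).map_source hx)
  refine ⟨by rw [hu0, (extChartAt I x₀).left_inv hx],
    ((contMDiffOn_extChartAt_symm (I := I) (n := ∞) x₀).contMDiffAt ht).comp 0 hu, ?_⟩
  filter_upwards [hu.continuousAt.preimage_mem_nhds ht] with τ hτ
  exact ⟨(extChartAt I x₀).map_target hτ, (extChartAt I x₀).right_inv hτ⟩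

theorem hasDerivAt_add_smul_const (a b : F) : HasDerivAt (fun τ : 𝕜 => a + τ • b) b 0 := by
  simpa using ((hasDerivAt_id (0 : 𝕜)).smul_const b).const_add a

theorem exists_path_of_tangentVector [I.Boundaryless] [IsManifold I ∞ X] (x : X)
    (v : TangentSpace I x) :
    ∃ c : 𝕜 → X, c 0 = x ∧ ContMDiffAt 𝓘(𝕜, 𝕜) I ∞ c 0 ∧
      mfderiv 𝓘(𝕜, 𝕜) I c 0 (1 : 𝕜) = v := by
  change E at v
  -- The path is a straight line in the chart at `x`, where the velocity is read off directly.
  let u : 𝕜 → E := fun τ => extChartAt I x x + τ • v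
  have hu0 : u 0 = extChartAt I x x := by simp [u]
  have hu : ContDiff 𝕜 ∞ u := contDiff_const.add (contDiff_id.smul contDiff_const)
  obtain ⟨h0, hc, he⟩ := contMDiffAt_extChartAt_symm_comp (I := I) (mem_extChartAt_source x)
    hu.contMDiff.contMDiffAt hu0
  refine ⟨_, h0, hc, ?_⟩
  have hd : HasFDerivAt u (ContinuousLinearMap.toSpanSingleton 𝕜 v) 0 :=
    (hasDerivAt_add_smul_const _ v).hasFDerivAt
  have hm : HasMFDerivAt 𝓘(𝕜, 𝕜) I (fun τ => (extChartAt I x).symm (u τ)) 0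
      (ContinuousLinearMap.toSpanSingleton 𝕜 v) := by
    refine ⟨hc.continuousAt, HasFDerivAt.hasFDerivWithinAt ?_⟩
    refine hd.congr_of_eventuallyEq ?_
    filter_upwards [he] with τ hτ
    simp only [writtenInExtChartAt, h0, extChartAt_model_space_eq_id, PartialEquiv.refl_symm,
      PartialEquiv.refl_coe, Function.comp_apply, id_eq]
    exact hτ.2
  rw [hm.mfderiv]
  exact one_smul 𝕜 _

/-- The derivative of `f` at `y` is onto if every vector is the velocity of `f ∘ c` for a path `c`
through `y`. -/
theorem mfderiv_surjective_of_paths {f : X → F} {y : X}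
    (hf : MDifferentiableAt I 𝓘(𝕜, F) f y)
    (h : ∀ w : F, ∃ c : 𝕜 → X, c 0 = y ∧ ContMDiffAt 𝓘(𝕜, 𝕜) I ∞ c 0 ∧
      ∀ᶠ τ in 𝓝 (0 : 𝕜), f (c τ) = f y + τ • w) :
    Function.Surjective (mfderiv I 𝓘(𝕜, F) f y) := by
  intro w
  change F at w
  obtain ⟨c, rfl, hc, he⟩ := h w
  have hcd := hc.mdifferentiableAt (by simp)
  refine ⟨mfderiv 𝓘(𝕜, 𝕜) I c 0 (1 : 𝕜), ?_⟩
  have h1 := mfderiv_comp (0 : 𝕜) hf hcd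
  have h2 : HasDerivAt (f ∘ c) w 0 :=
    (hasDerivAt_add_smul_const (f (c 0)) w).congr_of_eventuallyEq he
  rw [mfderiv_eq_fderiv, h2.hasFDerivAt.fderiv] at h1
  have h3 := congrArg (fun T : 𝕜 →L[𝕜] F => T 1) h1
  exact h3.symm.trans (one_smul 𝕜 w)

/-- A subset with local defining functions, whose values are moved freely by smooth paths, is an
embedded submanifold. -/
theorem isEmbeddedSubmanifold_of_paths [FiniteDimensional 𝕜 F] (A : Set X)
    (h : ∀ x ∈ A, ∃ U : Set X, IsOpen U ∧ x ∈ U ∧ ∃ f : X → F, ContMDiffOn I 𝓘(𝕜, F) ∞ f U ∧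
      (∀ y ∈ U, ∀ w : F, ∃ c : 𝕜 → X, c 0 = y ∧ ContMDiffAt 𝓘(𝕜, 𝕜) I ∞ c 0 ∧
        ∀ᶠ τ in 𝓝 (0 : 𝕜), f (c τ) = f y + τ • w) ∧
      ∀ y ∈ U, y ∈ A ↔ f y = 0) :
    IsEmbeddedSubmanifold I A := by
  -- A choice of basis turns `F`-valued defining functions into functions with values in `𝕜 ^ c`.
  let e : F ≃L[𝕜] (Fin (Module.finrank 𝕜 F) → 𝕜) :=
    (Module.finBasis 𝕜 F).equivFunL
  refine ⟨Module.finrank 𝕜 F, fun x hx => ?_⟩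
  obtain ⟨U, hU, hxU, f, hf, hc, hA⟩ := h x hx
  have hef : ContMDiffOn I 𝓘(𝕜, Fin (Module.finrank 𝕜 F) → 𝕜) ∞ (fun y => e (f y)) U :=
    (e : F →L[𝕜] (Fin (Module.finrank 𝕜 F) → 𝕜)).contMDiff.comp_contMDiffOn hf
  refine ⟨U, hU, hxU, fun y => e (f y), hef, fun y hy => ?_, fun y hy => ?_⟩
  · refine mfderiv_surjective_of_paths
      ((hef.contMDiffAt (hU.mem_nhds hy)).mdifferentiableAt (by simp)) fun w => ?_
    obtain ⟨c, hc0, hc1, hc2⟩ := hc y hy (e.symm w)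
    refine ⟨c, hc0, hc1, hc2.mono fun τ hτ => ?_⟩
    rw [hτ, map_add, map_smul, e.apply_symm_apply]
  · rw [hA y hy, map_eq_zero_iff e e.injective]

theorem IsEmbeddedSubmanifold.prod_univ {A : Set X} (hA : IsEmbeddedSubmanifold I A) :
    IsEmbeddedSubmanifold (I.prod J) (A ×ˢ (univ : Set Y)) := by
  obtain ⟨c, hc⟩ := hA
  refine ⟨c, fun x hx => ?_⟩
  obtain ⟨U, hU, hxU, f, hf, hs, hz⟩ := hc x.1 hx.1
  refine ⟨U ×ˢ univ, hU.prod isOpen_univ, ⟨hxU, mem_univ _⟩, fun p => f p.1,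
    hf.comp contMDiff_fst.contMDiffOn fun p hp => hp.1, fun y hy => ?_, fun y hy => ?_⟩
  · intro w
    obtain ⟨v, hv⟩ := hs y.1 hy.1 w
    have h1 := mfderiv_comp y
      ((hf.contMDiffAt (hU.mem_nhds hy.1)).mdifferentiableAt (by simp))
      (mdifferentiableAt_fst (I := I) (I' := J))
    rw [mfderiv_fst] at h1
    refine ⟨(v, 0), ?_⟩
    exact (congrArg (fun T : E × E' →L[𝕜] (Fin c → 𝕜) => T (v, 0)) h1).trans hv
  · simpa using hz y.1 hy.1

/-- The graph `{(φ y, y)}` of a smooth map is an embedded submanifold. -/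
theorem isEmbeddedSubmanifold_graph [FiniteDimensional 𝕜 E] [I.Boundaryless] [IsManifold I ∞ X]
    {φ : Y → X} (hφ : ContMDiff J I ∞ φ) :
    IsEmbeddedSubmanifold (I.prod J) (range fun y => (φ y, y)) := by
  refine isEmbeddedSubmanifold_of_paths (F := E) _ ?_
  rintro _ ⟨y₀, rfl⟩
  let χ := extChartAt I (φ y₀)
  have hχ : ContMDiffOn I 𝓘(𝕜, E) ∞ χ χ.source := by
    simpa only [χ, extChartAt_source] using contMDiffOn_extChartAt (I := I) (n := ∞) (x := φ y₀)
  have hχo : IsOpen χ.source := isOpen_extChartAt_source _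
  have hφ2 : ContMDiff (I.prod J) I ∞ fun p : X × Y => φ p.2 := hφ.comp contMDiff_snd
  -- The graph is the zero set of `χ x - χ (φ y)`. Moving `x` alone along lines in the chart gives
  -- this difference any velocity.
  refine ⟨Prod.fst ⁻¹' χ.source ∩ (fun p => φ p.2) ⁻¹' χ.source,
    (hχo.preimage continuous_fst).inter (hχo.preimage hφ2.continuous),
    ⟨mem_extChartAt_source _, mem_extChartAt_source _⟩, fun p => χ p.1 - χ (φ p.2), ?_, ?_, ?_⟩
  · exact (hχ.comp contMDiff_fst.contMDiffOn fun p hp => hp.1).sub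
      (hχ.comp hφ2.contMDiffOn fun p hp => hp.2)
  · rintro ⟨x, y⟩ ⟨hx, hy⟩ w
    have hu : ContDiff 𝕜 ∞ fun τ : 𝕜 => χ x + τ • w :=
      contDiff_const.add (contDiff_id.smul contDiff_const)
    obtain ⟨h0, hc, he⟩ := contMDiffAt_extChartAt_symm_comp (I := I) (x₀ := φ y₀) hx
      hu.contMDiff.contMDiffAt (by simp [χ])
    refine ⟨fun τ => (χ.symm (χ x + τ • w), y), Prod.ext h0 rfl, hc.prodMk contMDiffAt_const, ?_⟩
    filter_upwards [he] with τ hτ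
    rw [hτ.2]
    abel
  · rintro ⟨x, y⟩ ⟨hx, hy⟩
    rw [sub_eq_zero]
    constructor
    · rintro ⟨y', h⟩
      obtain ⟨rfl, rfl⟩ := Prod.mk.injEq .. ▸ h
      rfl
    · intro h
      exact ⟨y, Prod.ext (χ.injOn hy hx h.symm) rfl⟩

theorem isEmbeddedSubmanifold_diagonal [FiniteDimensional 𝕜 E] [I.Boundaryless]
    [IsManifold I ∞ X] : IsEmbeddedSubmanifold (I.prod I) (diagonal X) := by
  rw [← range_diag]
  exact isEmbeddedSubmanifold_graph (contMDiff_id (I := I) (M := X))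

/-- The velocity of a path at time `0`. -/
noncomputable def velocity (I : ModelWithCorners 𝕜 E H) (c : 𝕜 → X) : E :=
  mfderiv 𝓘(𝕜, 𝕜) I c 0 (1 : 𝕜)

theorem velocity_prodMk {c : 𝕜 → X} {d : 𝕜 → Y} (hc : ContMDiffAt 𝓘(𝕜, 𝕜) I ∞ c 0)
    (hd : ContMDiffAt 𝓘(𝕜, 𝕜) J ∞ d 0) :
    velocity (I.prod J) (fun τ => (c τ, d τ)) = (velocity I c, velocity J d) := by
  unfold velocity
  rw [mfderiv_prodMk (hc.mdifferentiableAt (by simp)) (hd.mdifferentiableAt (by simp))]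
  rfl

theorem velocity_comp {f : X → Y} {c : 𝕜 → X} {x : X} (hx : c 0 = x)
    (hf : MDifferentiableAt I J f x) (hc : ContMDiffAt 𝓘(𝕜, 𝕜) I ∞ c 0) :
    velocity J (fun τ => f (c τ)) = mfderiv I J f x (velocity I c : E) := by
  subst hx
  exact congrArg (fun T : 𝕜 →L[𝕜] E' => T 1)
    (mfderiv_comp (0 : 𝕜) hf (hc.mdifferentiableAt (by simp)))

theorem velocity_const (x : X) : velocity I (fun _ : 𝕜 => x) = 0 := by
  unfold velocity
  rw [mfderiv_const]
  rfl

theorem velocity_congr {c d : 𝕜 → X} (h : ∀ᶠ τ in 𝓝 (0 : 𝕜), c τ = d τ) :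
    velocity I c = velocity I d := by
  have h' : c =ᶠ[𝓝 0] d := h
  unfold velocity
  exact congrArg (fun T : 𝕜 →L[𝕜] E => T 1) h'.mfderiv_eq

/-- A smooth path that stays in `A`, followed by a map that is smooth on `A`. -/
theorem ContMDiffOn.comp_path {f : X → Y} {A : Set X} (hf : ContMDiffOn I J ∞ f A) {c : 𝕜 → X}
    (hc : ContMDiffAt 𝓘(𝕜, 𝕜) I ∞ c 0) (hA : ∀ᶠ τ in 𝓝 (0 : 𝕜), c τ ∈ A) :
    ContMDiffAt 𝓘(𝕜, 𝕜) J ∞ (fun τ => f (c τ)) 0 :=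
  ((hf _ hA.self_of_nhds).comp (0 : 𝕜) (hc.contMDiffWithinAt (s := c ⁻¹' A))
    (mapsTo_preimage _ _)).contMDiffAt hA

/-- A locally closed set is open in its closure, which here is the whole space. This makes `φ ⁻¹ S`
open in `Z`. -/
theorem IsLocallyClosed.isOpen_of_dense {A : Set X} (hA : IsLocallyClosed A) (hd : Dense A) :
    IsOpen A := by
  have := hA.isOpen_preimage_val_closure
  rw [hd.closure_eq] at this
  exact (IsOpen.isOpenEmbedding_subtypeVal isOpen_univ).isOpen_iff_preimage_isOpen (by simp) |>.2
    this

theorem IsEmbeddedSubmanifold.isLocallyClosed {A : Set X} (hA : IsEmbeddedSubmanifold I A) :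
    IsLocallyClosed A := by
  obtain ⟨c, hc⟩ := hA
  refine ((isLocallyClosed_tfae A).out 0 2).2 fun x hx => ?_
  obtain ⟨U, hU, hxU, f, hf, -, hA⟩ := hc x hx
  refine ⟨U, hU.mem_nhds hxU, ?_⟩
  have h1 : Continuous fun y : U => f y := continuousOn_iff_continuous_domRestrict.1 hf.continuousOn
  convert isClosed_singleton (x := (0 : Fin c → 𝕜)) |>.preimage h1 using 1
  ext y
  exact hA y y.2

end Paths

/-! ## The product with the pair groupoid and the natural Morita equivalence -/

/-- Such an `f` is a homeomorphism onto `C` followed by a closed embedding. For a free action whose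
orbits are the fibres of a map, the inverse `g` is division in the groupoid. -/
theorem isProperMap_of_closed_range {X Y : Type*} [TopologicalSpace X] [TopologicalSpace Y]
    {f : X → Y} (hf : Continuous f) {C : Set Y} (hC : IsClosed C) (hfC : ∀ x, f x ∈ C)
    (g : C → X) (hg : Continuous g) (hgf : ∀ x, g ⟨f x, hfC x⟩ = x) (hfg : ∀ y, f (g y) = y) :
    IsProperMap f := by
  let e : X ≃ₜ C :=
    { toFun := fun x => ⟨f x, hfC x⟩
      invFun := g
      left_inv := hgf
      right_inv := fun y => Subtype.ext (hfg y)
      continuous_toFun := hf.subtype_mk _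
      continuous_invFun := hg }
  exact hC.isClosedEmbedding_subtypeVal.isProperMap.comp e.isProperMap

namespace SetGroupoid

/-! ### Cancellation laws in groupoids and right modules -/

section Cancellation

variable {G M Z : Type*} (Γ : SetGroupoid G M)

theorem mul_mul_inv {g h : G} (e : Γ.tgt g = Γ.src h) : Γ.mul (Γ.mul g h) (Γ.inv h) = g := by
  rw [Γ.mul_assoc _ _ _ e (Γ.src_inv h).symm, Γ.mul_inv, ← e, Γ.mul_unit]

theorem inv_mul_mul {g h : G} (e : Γ.tgt g = Γ.src h) : Γ.mul (Γ.inv g) (Γ.mul g h) = h := by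
  rw [← Γ.mul_assoc _ _ _ (Γ.tgt_inv g) e, Γ.inv_mul, e, Γ.unit_mul]

theorem inv_inv (g : G) : Γ.inv (Γ.inv g) = g :=
  (Γ.eq_inv_of_mul (Γ.tgt_inv g) (by rw [Γ.inv_mul, Γ.src_inv])).symm

theorem mul_inv_mul {g h : G} (e : Γ.tgt g = Γ.tgt h) : Γ.mul (Γ.mul g (Γ.inv h)) h = g := by
  have := Γ.mul_mul_inv (g := g) (h := Γ.inv h) (by rw [Γ.src_inv, e])
  rwa [Γ.inv_inv] at this

theorem mul_inv_mul' {g h : G} (e : Γ.src g = Γ.src h) : Γ.mul g (Γ.mul (Γ.inv g) h) = h := by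
  have := Γ.inv_mul_mul (g := Γ.inv g) (h := h) (by rw [Γ.tgt_inv, e])
  rwa [Γ.inv_inv] at this

theorem mul_right_cancel {g h x : G} (hg : Γ.tgt g = Γ.src x) (hh : Γ.tgt h = Γ.src x)
    (e : Γ.mul g x = Γ.mul h x) : g = h := by
  rw [← Γ.mul_mul_inv hg, e, Γ.mul_mul_inv hh]

theorem mul_left_cancel {g h x : G} (hg : Γ.tgt x = Γ.src g) (hh : Γ.tgt x = Γ.src h)
    (e : Γ.mul x g = Γ.mul x h) : g = h := by
  rw [← Γ.inv_mul_mul hg, e, Γ.inv_mul_mul hh]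

variable {Γ}

theorem RightModule.act_act_inv (N : Γ.RightModule Z) {z : Z} {g : G} (h : N.anchor z = Γ.src g) :
    N.act (N.act z g) (Γ.inv g) = z := by
  rw [← N.act_mul _ _ _ h (Γ.src_inv g).symm, Γ.mul_inv, ← h, N.act_unit]

theorem RightModule.act_inv_act (N : Γ.RightModule Z) {z : Z} {g : G} (h : N.anchor z = Γ.tgt g) :
    N.act (N.act z (Γ.inv g)) g = z := by
  rw [← N.act_mul _ _ _ (by rw [h, Γ.src_inv]) (Γ.tgt_inv g), Γ.inv_mul, ← h, N.act_unit]

end Cancellation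

/-! ### Stable subsets under the product and the natural bimodule -/

section Stable

variable {G M G' M' Z : Type*} {Γ : SetGroupoid G M}

theorem IsStable.prod_univ {S : Set M} (hS : Γ.IsStable S) (Γ' : SetGroupoid G' M') :
    (Γ.prod Γ').IsStable (S ×ˢ univ) := fun g => by
  simpa [SetGroupoid.prod] using hS g.1

theorem naturalBimodule_mapStable {S : Set M} (hS : Γ.IsStable S) :
    (Γ.naturalBimodule Z).mapStable S = S ×ˢ univ := by
  ext ⟨m, z⟩
  constructor
  · rintro ⟨x, hx, h⟩
    obtain ⟨rfl, -⟩ := Prod.mk.injEq .. ▸ h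
    exact ⟨(hS x.1).2 hx, mem_univ _⟩
  · rintro ⟨hm, -⟩
    refine ⟨(Γ.unit m, z), ?_, ?_⟩
    · change Γ.src (Γ.unit m) ∈ S
      rwa [Γ.src_unit]
    · exact Prod.ext (Γ.tgt_unit m) rfl

end Stable

/-! ### The Lie groupoid structure of the product and the Morita equivalence -/

section

variable {𝕜 : Type*} [RCLike 𝕜]
  {E₁ H₁ G : Type*} [NormedAddCommGroup E₁] [NormedSpace 𝕜 E₁] [TopologicalSpace H₁]
  [TopologicalSpace G] [ChartedSpace H₁ G]
  {E₂ H₂ M : Type*} [NormedAddCommGroup E₂] [NormedSpace 𝕜 E₂] [TopologicalSpace H₂]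
  [TopologicalSpace M] [ChartedSpace H₂ M]
  {E₃ H₃ Z : Type*} [NormedAddCommGroup E₃] [NormedSpace 𝕜 E₃] [TopologicalSpace H₃]
  [TopologicalSpace Z] [ChartedSpace H₃ Z]
  {E₄ H₄ G' : Type*} [NormedAddCommGroup E₄] [NormedSpace 𝕜 E₄] [TopologicalSpace H₄]
  [TopologicalSpace G'] [ChartedSpace H₄ G']
  {E₅ H₅ M' : Type*} [NormedAddCommGroup E₅] [NormedSpace 𝕜 E₅] [TopologicalSpace H₅]
  [TopologicalSpace M'] [ChartedSpace H₅ M']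
  {I : ModelWithCorners 𝕜 E₁ H₁} {J : ModelWithCorners 𝕜 E₂ H₂} {K : ModelWithCorners 𝕜 E₃ H₃}
  {I' : ModelWithCorners 𝕜 E₄ H₄} {J' : ModelWithCorners 𝕜 E₅ H₅}
  {Γ : SetGroupoid G M} {Γ' : SetGroupoid G' M'}

theorem isLie_pair [IsManifold K ∞ Z] : (pair Z).IsLie (K.prod K) K where
  src := Manifold.IsSubmersion.id.comp_fst
  tgt := Manifold.isSubmersion_snd
  unit := contMDiff_id.prodMk contMDiff_id
  inv := contMDiff_snd.prodMk contMDiff_fst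
  mul := ((contMDiff_fst.comp contMDiff_fst).prodMk
    (contMDiff_snd.comp contMDiff_snd)).contMDiffOn

theorem IsLie.prod [IsManifold I ∞ G] [IsManifold J ∞ M] [IsManifold I' ∞ G']
    [IsManifold J' ∞ M'] (h : Γ.IsLie I J) (h' : Γ'.IsLie I' J') :
    (Γ.prod Γ').IsLie (I.prod I') (J.prod J') where
  src := h.src.prodMap h'.src
  tgt := h.tgt.prodMap h'.tgt
  unit := h.unit.prodMap h'.unit
  inv := h.inv.prodMap h'.inv
  mul := by
    have h1 : ContMDiff ((I.prod I').prod (I.prod I')) (I.prod I) ∞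
        fun q : (G × G') × (G × G') => (q.1.1, q.2.1) :=
      (contMDiff_fst.comp contMDiff_fst).prodMk (contMDiff_fst.comp contMDiff_snd)
    have h2 : ContMDiff ((I.prod I').prod (I.prod I')) (I'.prod I') ∞
        fun q : (G × G') × (G × G') => (q.1.2, q.2.2) :=
      (contMDiff_snd.comp contMDiff_fst).prodMk (contMDiff_snd.comp contMDiff_snd)
    have h3 : ∀ q : (G × G') × (G × G'), (Γ.prod Γ').tgt q.1 = (Γ.prod Γ').src q.2 →
        Γ.tgt q.1.1 = Γ.src q.2.1 ∧ Γ'.tgt q.1.2 = Γ'.src q.2.2 := fun q hq => Prod.ext_iff.1 hq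
    exact (h.mul.comp h1.contMDiffOn fun q hq => (h3 q hq).1).prodMk
      (h'.mul.comp h2.contMDiffOn fun q hq => (h3 q hq).2)

theorem naturalBimodule_isMorita [IsManifold I ∞ G] [IsManifold J ∞ M] [IsManifold K ∞ Z]
    [T2Space M] [T2Space Z] [Nonempty Z] (hΓ : Γ.IsLie I J) :
    (Γ.naturalBimodule Z).IsMorita I J (I.prod (K.prod K)) (J.prod K) (I.prod K) := by
  have hmul : ContinuousOn (fun q : G × G => Γ.mul q.1 q.2) {q | Γ.tgt q.1 = Γ.src q.2} :=
    hΓ.mul.continuousOn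
  have hsrc := hΓ.src.contMDiff.continuous
  have htgt := hΓ.tgt.contMDiff.continuous
  have hinv := hΓ.inv.continuous
  refine
    { smooth_left := ⟨hΓ.src.contMDiff.comp contMDiff_fst, ?_⟩
      smooth_right := ⟨(hΓ.tgt.prodMap Manifold.IsSubmersion.id).contMDiff, ?_⟩
      surjective_left := fun m => ?_
      submersion_left := hΓ.src.comp_fst
      surjective_right := fun m => ⟨(Γ.unit m.1, m.2), Prod.ext (Γ.tgt_unit _) rfl⟩
      submersion_right := hΓ.tgt.prodMap Manifold.IsSubmersion.id
      free_left := ?_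
      free_right := ?_
      transitive_left := ?_
      transitive_right := ?_
      proper_left := ?_
      proper_right := ?_ }
  · have h1 : ContMDiff (I.prod (I.prod K)) (I.prod I) ∞
        fun q : G × (G × Z) => (q.1, q.2.1) :=
      contMDiff_fst.prodMk (contMDiff_fst.comp contMDiff_snd)
    have h2 : ContMDiff (I.prod (I.prod K)) K ∞ fun q : G × (G × Z) => q.2.2 :=
      contMDiff_snd.comp contMDiff_snd
    exact (hΓ.mul.comp h1.contMDiffOn fun q hq => hq).prodMk h2.contMDiffOn
  · have h1 : ContMDiff ((I.prod K).prod (I.prod (K.prod K))) (I.prod I) ∞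
        fun q : (G × Z) × (G × (Z × Z)) => (q.1.1, q.2.1) :=
      (contMDiff_fst.comp contMDiff_fst).prodMk (contMDiff_fst.comp contMDiff_snd)
    have h2 : ContMDiff ((I.prod K).prod (I.prod (K.prod K))) K ∞
        fun q : (G × Z) × (G × (Z × Z)) => q.2.2.2 :=
      contMDiff_snd.comp (contMDiff_snd.comp contMDiff_snd)
    have h3 : ∀ q : (G × Z) × (G × (Z × Z)), (Γ.tgt q.1.1, q.1.2) = (Γ.src q.2.1, q.2.2.1) →
        Γ.tgt q.1.1 = Γ.src q.2.1 ∧ q.1.2 = q.2.2.1 := fun q hq => Prod.ext_iff.1 hq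
    exact (hΓ.mul.comp h1.contMDiffOn fun q hq => (h3 q hq).1).prodMk h2.contMDiffOn
  -- A point of `Z` is needed for `p (γ, z) = src γ` to reach every object.
  · exact ⟨(Γ.unit m, Classical.arbitrary Z), Γ.src_unit m⟩
  · rintro g h x (hg : _ = Γ.src x.1) (hh : _ = Γ.src x.1) e
    exact Γ.mul_right_cancel hg hh (congrArg Prod.fst e)
  · rintro x g h hg hh e
    refine Prod.ext (Γ.mul_left_cancel (congrArg Prod.fst hg) (congrArg Prod.fst hh)
      (congrArg Prod.fst e)) (Prod.ext ?_ (Prod.ext_iff.1 e).2)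
    exact (congrArg Prod.snd hg).symm.trans (congrArg Prod.snd hh)
  · rintro x y h
    have h1 : Γ.tgt x.1 = Γ.tgt y.1 := congrArg Prod.fst h
    refine ⟨Γ.mul y.1 (Γ.inv x.1), ?_, Prod.ext ?_ (Prod.ext_iff.1 h).2⟩
    · rw [Γ.tgt_mul _ _ (by rw [Γ.src_inv, h1]), Γ.tgt_inv]
      rfl
    · exact Γ.mul_inv_mul h1.symm
  · rintro x y (h : Γ.src x.1 = Γ.src y.1)
    refine ⟨(Γ.mul (Γ.inv x.1) y.1, (x.2, y.2)), Prod.ext ?_ rfl, Prod.ext ?_ rfl⟩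
    · change Γ.tgt x.1 = Γ.src (Γ.mul (Γ.inv x.1) y.1)
      rw [Γ.src_mul _ _ (by rw [Γ.tgt_inv, h]), Γ.src_inv]
    · exact Γ.mul_inv_mul' h
  -- The left action identifies its domain with the pairs of points in the same fibre of `p'`; the
  -- arrow is recovered as `γ γ'⁻¹`. The equations take place in `M` and `Z`, so closedness requires
  -- only these to be Hausdorff.
  · have hC : IsClosed {y : (G × Z) × (G × Z) | Γ.tgt y.1.1 = Γ.tgt y.2.1 ∧ y.1.2 = y.2.2} :=
      (isClosed_eq (by fun_prop) (by fun_prop)).inter (isClosed_eq (by fun_prop) (by fun_prop))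
    refine isProperMap_of_closed_range (C := {y | _}) ?_ hC
      (fun q => ⟨Γ.tgt_mul _ _ q.2, rfl⟩)
      (fun y => ⟨(Γ.mul y.1.1.1 (Γ.inv y.1.2.1), y.1.2), ?_⟩) ?_ ?_ ?_
    · refine Continuous.prodMk (Continuous.prodMk ?_ (by fun_prop)) (by fun_prop)
      exact hmul.comp_continuous (f := fun q : {q : G × (G × Z) // _} => (q.1.1, q.1.2.1))
        (by fun_prop) fun q => q.2
    · change Γ.tgt _ = Γ.src y.1.2.1
      rw [Γ.tgt_mul _ _ (by rw [Γ.src_inv, y.2.1]), Γ.tgt_inv]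
    · refine Continuous.subtype_mk (Continuous.prodMk ?_ (by fun_prop)) _
      exact hmul.comp_continuous
        (f := fun y : {y : (G × Z) × (G × Z) // _} => (y.1.1.1, Γ.inv y.1.2.1))
        (by fun_prop) fun y => y.2.1.trans (Γ.src_inv _).symm
    · rintro ⟨⟨g, x⟩, hg⟩
      exact Subtype.ext (Prod.ext (Γ.mul_mul_inv hg) rfl)
    · rintro ⟨⟨x, y⟩, hxy⟩
      exact Prod.ext (Prod.ext (Γ.mul_inv_mul hxy.1) hxy.2.symm) rfl
  -- Likewise the right action has as its image the pairs in the same fibre of `p`, and the arrow is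
  -- `(γ⁻¹ γ', (z, z'))`.
  · have hC : IsClosed {y : (G × Z) × (G × Z) | Γ.src y.1.1 = Γ.src y.2.1} :=
      isClosed_eq (by fun_prop) (by fun_prop)
    refine isProperMap_of_closed_range (C := {y | _}) ?_ hC
      (fun q => (Γ.src_mul _ _ (congrArg Prod.fst q.2)).symm)
      (fun y => ⟨(y.1.1, (Γ.mul (Γ.inv y.1.1.1) y.1.2.1, (y.1.1.2, y.1.2.2))), ?_⟩) ?_ ?_ ?_
    · refine Continuous.prodMk (by fun_prop) (Continuous.prodMk ?_ (by fun_prop))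
      exact hmul.comp_continuous
        (f := fun q : {q : (G × Z) × (G × (Z × Z)) // _} => (q.1.1.1, q.1.2.1))
        (by fun_prop) fun q => congrArg Prod.fst q.2
    · refine Prod.ext ?_ rfl
      change Γ.tgt _ = Γ.src _
      rw [Γ.src_mul _ _ (by rw [Γ.tgt_inv]; exact y.2), Γ.src_inv]
    · refine Continuous.subtype_mk (Continuous.prodMk (by fun_prop)
        (Continuous.prodMk ?_ (by fun_prop))) _
      exact hmul.comp_continuous
        (f := fun y : {y : (G × Z) × (G × Z) // _} => (Γ.inv y.1.1.1, y.1.2.1))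
        (by fun_prop) fun y => (Γ.tgt_inv _).trans y.2
    · rintro ⟨⟨x, g⟩, hg⟩
      refine Subtype.ext (Prod.ext rfl (Prod.ext ?_ (Prod.ext (congrArg Prod.snd hg) rfl)))
      exact Γ.inv_mul_mul (congrArg Prod.fst hg)
    · rintro ⟨⟨x, y⟩, hxy⟩
      exact Prod.ext rfl (Prod.ext (Γ.mul_inv_mul' hxy) rfl)

end

end SetGroupoid

namespace SetGroupoid

/-! ## The resolution `Z × Z` and the subgroupoid defined by the diagonal -/

section Sets

variable {G M Z : Type*} {Γ : SetGroupoid G M} (N : Γ.RightModule Z)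

/-- The point of the diagonal over `(φ z, z)` is `(z, z)`, and `(γ, (z, y))` sends it to `(z · γ,
y)`. So these arrows form the action groupoid of `Γ` on `Z`; all later statements on `R` use this
description. -/
theorem RightModule.mem_arrowsOf_diagonal {r : G × (Z × Z)} :
    r ∈ N.hat.arrowsOf (diagonal Z) ↔ N.anchor r.2.1 = Γ.src r.1 ∧ N.act r.2.1 r.1 = r.2.2 := by
  constructor
  · rintro ⟨⟨z, w⟩, (rfl : z = w), h1, h2⟩
    obtain ⟨h3, h4⟩ := Prod.ext_iff.1 h1
    replace h4 : z = r.2.1 := h4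
    subst h4
    exact ⟨h3, h2⟩
  · rintro ⟨h1, h2⟩
    exact ⟨(r.2.1, r.2.1), rfl, Prod.ext h1 rfl, h2⟩

theorem RightModule.mem_range_graph {m : M × Z} :
    (m ∈ range fun z => (N.anchor z, z)) ↔ N.anchor m.2 = m.1 := by
  constructor
  · rintro ⟨z, rfl⟩
    rfl
  · intro h
    exact ⟨m.2, Prod.ext h rfl⟩

/-- The continuous map `z ↦ (φ z, z)` carries the dense set `φ ⁻¹ S` into the intersection. -/
theorem RightModule.dense_graph_inter [TopologicalSpace M] [TopologicalSpace Z] {S : Set M}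
    (hφ : Continuous N.anchor) (hd : Dense (N.anchor ⁻¹' S)) :
    (range fun z => (N.anchor z, z)) ⊆
      closure ((range fun z => (N.anchor z, z)) ∩ S ×ˢ univ) := by
  rintro _ ⟨z, rfl⟩
  have hc : Continuous fun z => (N.anchor z, z) := by fun_prop
  refine map_mem_closure (f := fun z => (N.anchor z, z)) hc (hd z) fun y hy => ?_
  exact ⟨mem_range_self y, hy, mem_univ _⟩

end Sets

/-! ### Smoothness of the resolution, compatibility, and the closed full subgroupoid -/

section

variable {𝕜 : Type*} [RCLike 𝕜]
  {E₁ H₁ G : Type*} [NormedAddCommGroup E₁] [NormedSpace 𝕜 E₁] [TopologicalSpace H₁]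
  [TopologicalSpace G] [ChartedSpace H₁ G]
  {E₂ H₂ M : Type*} [NormedAddCommGroup E₂] [NormedSpace 𝕜 E₂] [TopologicalSpace H₂]
  [TopologicalSpace M] [ChartedSpace H₂ M]
  {E₃ H₃ Z : Type*} [NormedAddCommGroup E₃] [NormedSpace 𝕜 E₃] [TopologicalSpace H₃]
  [TopologicalSpace Z] [ChartedSpace H₃ Z]
  {I : ModelWithCorners 𝕜 E₁ H₁} {J : ModelWithCorners 𝕜 E₂ H₂} {K : ModelWithCorners 𝕜 E₃ H₃}
  {Γ : SetGroupoid G M} {N : Γ.RightModule Z} {S : Set M}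

theorem RightModule.IsEquivariantResolution.hat [Nonempty Z]
    (hN : N.IsEquivariantResolution I J K S) :
    N.hat.IsEquivariantResolution (I.prod (K.prod K)) (J.prod K) (K.prod K) (S ×ˢ univ) := by
  obtain ⟨⟨hφ, hact⟩, -, hd, hbij, hφS, hinv⟩ := hN
  have hanchor : ContMDiff (K.prod K) (J.prod K) ∞ N.hat.anchor := hφ.prodMap contMDiff_id
  refine ⟨⟨hanchor, ?_⟩, hanchor, ?_, ⟨?_, ?_, ?_⟩, hanchor.contMDiffOn, ?_⟩
  · have h1 : ContMDiff ((K.prod K).prod (I.prod (K.prod K))) (K.prod I) ∞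
        fun q : (Z × Z) × (G × (Z × Z)) => (q.1.1, q.2.1) :=
      (contMDiff_fst.comp contMDiff_fst).prodMk (contMDiff_fst.comp contMDiff_snd)
    have h2 : ContMDiff ((K.prod K).prod (I.prod (K.prod K))) K ∞
        fun q : (Z × Z) × (G × (Z × Z)) => q.2.2.2 :=
      contMDiff_snd.comp (contMDiff_snd.comp contMDiff_snd)
    have h3 : ∀ q : (Z × Z) × (G × (Z × Z)),
        (N.anchor q.1.1, q.1.2) = (Γ.src q.2.1, q.2.2.1) → N.anchor q.1.1 = Γ.src q.2.1 :=
      fun q hq => (Prod.ext_iff.1 hq).1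
    exact (hact.comp h1.contMDiffOn fun q hq => h3 q hq).prodMk h2.contMDiffOn
  · exact hd.prod dense_univ
  · exact fun w hw => ⟨hw.1, mem_univ _⟩
  · intro a ha b hb e
    obtain ⟨e1, e2⟩ := Prod.ext_iff.1 e
    exact Prod.ext (hbij.injOn ha.1 hb.1 e1) e2
  · rintro ⟨m, z⟩ ⟨hm, -⟩
    obtain ⟨y, hy, rfl⟩ := hbij.surjOn hm
    exact ⟨(y, z), ⟨hy, mem_univ _⟩, rfl⟩
  · intro g hg
    -- Every left inverse of `φ × id` agrees on `S × Z` with the product of one left inverse of `φ`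
    -- and the identity, so one choice suffices.
    have hl := hbij.injOn.leftInvOn_invFunOn
    have h1 : ContMDiffOn (J.prod K) (K.prod K) ∞
        (fun p : M × Z => (Function.invFunOn N.anchor (N.anchor ⁻¹' S) p.1, p.2)) (S ×ˢ univ) :=
      ((hinv _ hl).comp contMDiff_fst.contMDiffOn fun p hp => hp.1).prodMk
        contMDiff_snd.contMDiffOn
    refine h1.congr ?_
    rintro ⟨m, z⟩ ⟨hm, -⟩
    obtain ⟨y, hy, rfl⟩ := hbij.surjOn hm
    change _ = (Function.invFunOn N.anchor (N.anchor ⁻¹' S) (N.anchor y), z)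
    rw [hl hy]
    exact hg (x := (y, z)) ⟨hy, mem_univ _⟩

variable [FiniteDimensional 𝕜 E₂] [FiniteDimensional 𝕜 E₃] [J.Boundaryless] [K.Boundaryless]
  [IsManifold J ∞ M] [IsManifold K ∞ Z]

theorem RightModule.IsEquivariantResolution.isCompatibleVia_diagonal
    (hN : N.IsEquivariantResolution I J K S) :
    N.hat.IsCompatibleVia (I.prod (K.prod K)) (J.prod K) (K.prod K) (S ×ˢ univ)
      (range fun z => (N.anchor z, z)) (diagonal Z) := by
  obtain ⟨⟨hφ, hact⟩, -, hd, -⟩ := hN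
  have hanchor : ContMDiff (K.prod K) (J.prod K) ∞ N.hat.anchor := hφ.prodMap contMDiff_id
  refine ⟨isEmbeddedSubmanifold_graph hφ, N.dense_graph_inter hφ.continuous hd,
    isEmbeddedSubmanifold_diagonal, ⟨⟨?_, ?_, ?_⟩, hanchor.contMDiffOn, ?_⟩, ?_, ?_⟩
  · rintro ⟨z, w⟩ (rfl : z = w)
    exact ⟨z, rfl⟩
  · rintro ⟨z, w⟩ (rfl : z = w) ⟨y, w⟩ (rfl : y = w) e
    obtain rfl : z = y := (Prod.ext_iff.1 e).2
    rfl
  · rintro _ ⟨z, rfl⟩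
    exact ⟨(z, z), rfl, rfl⟩
  · intro g hg
    -- The inverse of the diagonal's projection to the graph extends to a globally smooth map.
    have h1 : ContMDiff (J.prod K) (K.prod K) ∞ fun p : M × Z => (p.2, p.2) :=
      contMDiff_snd.prodMk contMDiff_snd
    refine h1.contMDiffOn.congr ?_
    rintro _ ⟨z, rfl⟩
    exact hg (x := (z, z)) rfl
  · rintro ⟨z, w⟩ (rfl : z = w) v
    obtain ⟨v₁, v₂⟩ : E₃ × E₃ := v
    obtain ⟨c, hc0, hc, hcv⟩ := exists_path_of_tangentVector (I := K) z v₁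
    obtain ⟨d, hd0, hd, hdv⟩ := exists_path_of_tangentVector (I := K) z (v₂ - v₁ : E₃)
    -- The splitting is `(v₁, v₂) = (0, v₂ - v₁) + (v₁, v₁)`. The first summand comes from the pair
    -- groupoid alone, with a unit as the component in `Γ`.
    refine ⟨((0, v₂ - v₁) : E₃ × E₃), ⟨fun τ => (Γ.unit (N.anchor z), (z, d τ)), ?_,
      contMDiffAt_const.prodMk (contMDiffAt_const.prodMk hd), Eventually.of_forall fun τ => ?_,
      ?_⟩, ((v₁, v₁) : E₃ × E₃), ⟨fun τ => (c τ, c τ), Prod.ext hc0 hc0, hc.prodMk hc,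
      Eventually.of_forall fun τ => rfl, ?_⟩, ?_⟩
    · exact Prod.ext rfl (Prod.ext rfl hd0)
    · exact Prod.ext (Γ.src_unit _) rfl
    · have h1 : ∀ τ, N.hat.act (z, z) (Γ.unit (N.anchor z), (z, d τ)) = (z, d τ) := fun τ =>
        Prod.ext (N.act_unit z) rfl
      refine (velocity_congr (I := K.prod K) (Eventually.of_forall h1)).trans ?_
      refine (velocity_prodMk (I := K) contMDiffAt_const hd).trans (Prod.ext ?_ hdv)
      exact velocity_const _
    · exact (velocity_prodMk hc hc).trans (Prod.ext hcv hcv)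
    · exact Prod.ext (zero_add _).symm (sub_add_cancel _ _).symm
  · rintro ⟨z, y⟩ -
    exact ⟨(Γ.unit (N.anchor z), (y, z)), Prod.ext (Γ.src_unit _).symm rfl, N.act_unit z⟩

omit [FiniteDimensional 𝕜 E₂] [FiniteDimensional 𝕜 E₃] [K.Boundaryless] [J.Boundaryless]
  [IsManifold J ∞ M] [IsManifold K ∞ Z] in
-- The fibre product `φ z = s γ` is closed, and on it the action is continuous; `y = z · γ` is then
-- a closed condition.
theorem RightModule.isClosed_arrowsOf_diagonal [T2Space M] [T2Space Z]
    (hs : Continuous Γ.src) (hN : N.IsSmooth I J K) :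
    IsClosed (N.hat.arrowsOf (diagonal Z)) := by
  have hA : IsClosed {r : G × (Z × Z) | N.anchor r.2.1 = Γ.src r.1} :=
    isClosed_eq (hN.anchor.continuous.comp (by fun_prop)) (by fun_prop)
  have h1 : ContinuousOn (fun r : G × (Z × Z) => (N.act r.2.1 r.1, r.2.2))
      {r : G × (Z × Z) | N.anchor r.2.1 = Γ.src r.1} := by
    refine ContinuousOn.prodMk ?_ (by fun_prop)
    exact hN.act.continuousOn.comp (f := fun r : G × (Z × Z) => (r.2.1, r.1))
      (by fun_prop) fun r hr => hr
  convert h1.preimage_isClosed_of_isClosed hA isClosed_diagonal using 1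
  ext r
  exact N.mem_arrowsOf_diagonal

omit [FiniteDimensional 𝕜 E₂] [FiniteDimensional 𝕜 E₃] [K.Boundaryless] [J.Boundaryless]
  [IsManifold J ∞ M] [IsManifold K ∞ Z] in
theorem RightModule.isClosedIn_arrowsOf_diagonal [T2Space M] [T2Space Z]
    (hs : Continuous Γ.src) (hN : N.IsSmooth I J K) :
    (Γ.prod (pair Z)).IsClosedIn (N.hat.arrowsOf (diagonal Z))
      (range fun z => (N.anchor z, z)) := by
  -- `R` is closed among all arrows, and its sources and targets already lie in `L`, so it serves as
  -- its own closed set.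
  refine ⟨_, N.isClosed_arrowsOf_diagonal hs hN, (inter_eq_left.2 fun r hr => ?_).symm⟩
  obtain ⟨h1, h2⟩ := N.mem_arrowsOf_diagonal.1 hr
  refine ⟨N.mem_range_graph.2 h1, N.mem_range_graph.2 ?_⟩
  change N.anchor r.2.2 = Γ.tgt r.1
  rw [← h2, N.anchor_act _ _ h1]

variable [I.Boundaryless] [IsManifold I ∞ G]

omit [FiniteDimensional 𝕜 E₂] [FiniteDimensional 𝕜 E₃] [K.Boundaryless] [J.Boundaryless]
  [IsManifold K ∞ Z] in
/-- The action extends smoothly to a neighbourhood of the fibre product. -/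
theorem RightModule.IsSmooth.exists_extension (hN : N.IsSmooth I J K) (hΓ : Γ.IsLie I J) {z₀ : Z}
    {g₀ : G} (h₀ : N.anchor z₀ = Γ.src g₀) :
    ∃ U : Set (Z × G), IsOpen U ∧ (z₀, g₀) ∈ U ∧ ∃ A : Z × G → Z,
      ContMDiffOn (K.prod I) K ∞ A U ∧
      ∀ z g, (z, g) ∈ U → N.anchor z = Γ.src g → A (z, g) = N.act z g := by
  obtain ⟨W, hW, hmem, ρ, hρ, h1, h2⟩ := (hΓ.src.isSubmersionAt g₀).exists_retraction
  have hm : ContMDiff (K.prod I) (J.prod I) ∞ fun q : Z × G => (N.anchor q.1, q.2) :=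
    hN.anchor.prodMap contMDiff_id
  -- The retraction moves `g` to an arrow with source `φ z`, so that the action applies; it fixes
  -- `g` when the source is already `φ z`.
  refine ⟨_, hW.preimage hm.continuous, ?_, fun q => N.act q.1 (ρ (N.anchor q.1, q.2)), ?_, ?_⟩
  · rwa [mem_preimage, h₀]
  · refine hN.act.comp (contMDiff_fst.contMDiffOn.prodMk (hρ.comp hm.contMDiffOn fun q hq => hq))
      fun q hq => ?_
    exact (h1 _ hq).symm
  · intro z g hzg h
    change (N.anchor z, g) ∈ W at hzg
    change N.act z (ρ (N.anchor z, g)) = _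
    rw [h] at hzg ⊢
    rw [h2 _ hzg]

/-- In charts the defining equations are `χ (φ z) = χ (s g)` and `ξ y = ξ (A (z, g))`, where `A` is
a smooth extension of the action. The first difference is moved through the source of `g`, the
second through `y`. -/
theorem RightModule.isEmbeddedSubmanifold_arrowsOf_diagonal (hΓ : Γ.IsLie I J)
    (hN : N.IsSmooth I J K) :
    IsEmbeddedSubmanifold (I.prod (K.prod K)) (N.hat.arrowsOf (diagonal Z)) := by
  refine isEmbeddedSubmanifold_of_paths (F := E₂ × E₃) _ ?_
  rintro ⟨g₀, z₀, y₀⟩ hr₀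
  obtain ⟨h₀, h₀'⟩ := N.mem_arrowsOf_diagonal.1 hr₀
  change N.anchor z₀ = Γ.src g₀ at h₀
  change N.act z₀ g₀ = y₀ at h₀'
  obtain ⟨W, hW, hmem, ρ, hρ, hρ1, hρ2⟩ := (hΓ.src.isSubmersionAt g₀).exists_retraction
  obtain ⟨U, hU, hU₀, A, hA, hA1⟩ := hN.exists_extension hΓ h₀
  let χ := extChartAt J (Γ.src g₀)
  let ξ := extChartAt K y₀
  have hχ : ContMDiffOn J 𝓘(𝕜, E₂) ∞ χ χ.source := by
    simpa only [χ, extChartAt_source] using contMDiffOn_extChartAt (I := J) (n := ∞)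
  have hξ : ContMDiffOn K 𝓘(𝕜, E₃) ∞ ξ ξ.source := by
    simpa only [ξ, extChartAt_source] using contMDiffOn_extChartAt (I := K) (n := ∞)
  have hχo : IsOpen χ.source := isOpen_extChartAt_source _
  have hξo : IsOpen ξ.source := isOpen_extChartAt_source _
  have hp1 : ContMDiff (I.prod (K.prod K)) J ∞ fun r : G × (Z × Z) => Γ.src r.1 :=
    hΓ.src.contMDiff.comp contMDiff_fst
  have hp2 : ContMDiff (I.prod (K.prod K)) J ∞ fun r : G × (Z × Z) => N.anchor r.2.1 :=
    hN.anchor.comp (contMDiff_fst.comp contMDiff_snd)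
  have hp3 : ContMDiff (I.prod (K.prod K)) K ∞ fun r : G × (Z × Z) => r.2.2 :=
    contMDiff_snd.comp contMDiff_snd
  have hp4 : ContMDiff (I.prod (K.prod K)) (K.prod I) ∞ fun r : G × (Z × Z) => (r.2.1, r.1) :=
    (contMDiff_fst.comp contMDiff_snd).prodMk contMDiff_fst
  have hp5 : ContMDiff (I.prod (K.prod K)) (J.prod I) ∞ fun r : G × (Z × Z) => (Γ.src r.1, r.1) :=
    hp1.prodMk contMDiff_fst
  have hA' : ContMDiffOn (I.prod (K.prod K)) K ∞ (fun r : G × (Z × Z) => A (r.2.1, r.1))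
      ((fun r : G × (Z × Z) => (r.2.1, r.1)) ⁻¹' U) :=
    hA.comp hp4.contMDiffOn fun r hr => hr
  let V₁ : Set (G × (Z × Z)) := (fun r => Γ.src r.1) ⁻¹' χ.source ∩
    (fun r => N.anchor r.2.1) ⁻¹' χ.source ∩ (fun r => r.2.2) ⁻¹' ξ.source ∩
    (fun r => (Γ.src r.1, r.1)) ⁻¹' W
  let V₂ : Set (G × (Z × Z)) := (fun r => (r.2.1, r.1)) ⁻¹' U ∩
    (fun r : G × (Z × Z) => A (r.2.1, r.1)) ⁻¹' ξ.source
  have hV₁ : IsOpen V₁ := (((hχo.preimage hp1.continuous).inter (hχo.preimage hp2.continuous)).inter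
    (hξo.preimage hp3.continuous)).inter (hW.preimage hp5.continuous)
  have hV₂ : IsOpen V₂ :=
    hA'.continuousOn.isOpen_inter_preimage (hU.preimage hp4.continuous) hξo
  have hA₀ : A (z₀, g₀) = y₀ := by rw [hA1 _ _ hU₀ h₀, h₀']
  refine ⟨V₁ ∩ V₂, hV₁.inter hV₂, ⟨⟨⟨⟨mem_extChartAt_source _, ?_⟩, mem_extChartAt_source _⟩, hmem⟩,
    hU₀, ?_⟩, fun r => (χ (N.anchor r.2.1) - χ (Γ.src r.1), ξ r.2.2 - ξ (A (r.2.1, r.1))),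
    ?_, ?_, ?_⟩
  · change N.anchor z₀ ∈ χ.source
    rw [h₀]
    exact mem_extChartAt_source _
  · change A (z₀, g₀) ∈ ξ.source
    rw [hA₀]
    exact mem_extChartAt_source _
  · refine ContMDiffOn.prodMk_space ?_ ?_
    · exact (hχ.comp hp2.contMDiffOn fun r hr => hr.1.1.1.2).sub
        (hχ.comp hp1.contMDiffOn fun r hr => hr.1.1.1.1)
    · exact (hξ.comp hp3.contMDiffOn fun r hr => hr.1.1.2).sub
        (hξ.comp (hA'.mono fun r hr => hr.2.1) fun r hr => hr.2.2)
  · rintro ⟨g, z, y⟩ ⟨⟨⟨⟨hg, hz⟩, hy⟩, hgW⟩, hzg, hAs⟩ ⟨w₁, w₂⟩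
    change Γ.src g ∈ χ.source at hg
    change y ∈ ξ.source at hy
    change (Γ.src g, g) ∈ W at hgW
    change (z, g) ∈ U at hzg
    change A (z, g) ∈ ξ.source at hAs
    -- The source of `g` enters the first equation with a minus sign, hence the direction `-w₁`. The
    -- retraction lifts the path `m` of sources to a path `γ` of arrows.
    have hu : ContDiff 𝕜 ∞ fun τ : 𝕜 => χ (Γ.src g) + τ • (-w₁) :=
      contDiff_const.add (contDiff_id.smul contDiff_const)
    obtain ⟨hm0, hm, hme⟩ := contMDiffAt_extChartAt_symm_comp (I := J) (x₀ := Γ.src g₀) hg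
      hu.contMDiff.contMDiffAt (by simp [χ])
    set m : 𝕜 → M := fun τ => χ.symm (χ (Γ.src g) + τ • (-w₁)) with hmdef
    change m 0 = Γ.src g at hm0
    have hmW : ∀ᶠ τ in 𝓝 (0 : 𝕜), (m τ, g) ∈ W :=
      (hm.continuousAt.prodMk continuousAt_const).preimage_mem_nhds
        (hW.mem_nhds (by rwa [hm0]))
    let γ : 𝕜 → G := fun τ => ρ (m τ, g)
    have hγ : ContMDiffAt 𝓘(𝕜, 𝕜) I ∞ γ 0 := hρ.comp_path (hm.prodMk contMDiffAt_const) hmW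
    have hγ0 : γ 0 = g := by
      change ρ (m 0, g) = g
      rw [hm0, hρ2 _ hgW]
    have hγU : ∀ᶠ τ in 𝓝 (0 : 𝕜), (z, γ τ) ∈ U :=
      (continuousAt_const.prodMk hγ.continuousAt).preimage_mem_nhds
        (hU.mem_nhds (by rwa [hγ0]))
    have ha : ContMDiffAt 𝓘(𝕜, 𝕜) K ∞ (fun τ => A (z, γ τ)) 0 :=
      hA.comp_path (contMDiffAt_const.prodMk hγ) hγU
    have haξ : ∀ᶠ τ in 𝓝 (0 : 𝕜), A (z, γ τ) ∈ ξ.source :=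
      ha.continuousAt.preimage_mem_nhds (hξo.mem_nhds (by rwa [hγ0]))
    -- Moving `g` makes `A (z, γ τ)` drift. The path of `y` follows this drift in the chart and adds
    -- the prescribed difference.
    have hl : ContDiff 𝕜 ∞ fun τ : 𝕜 => ξ y - ξ (A (z, g)) + τ • w₂ :=
      contDiff_const.add (contDiff_id.smul contDiff_const)
    obtain ⟨hk0, hk, hke⟩ := contMDiffAt_extChartAt_symm_comp (I := K) (x₀ := y₀) hy
      ((hξ.comp_path ha haξ).add hl.contMDiff.contMDiffAt) (by simp [hγ0, ξ])
    refine ⟨fun τ => (γ τ, (z, ξ.symm (ξ (A (z, γ τ)) + (ξ y - ξ (A (z, g)) + τ • w₂)))), ?_,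
      hγ.prodMk (contMDiffAt_const.prodMk hk), ?_⟩
    · exact Prod.ext hγ0 (Prod.ext rfl hk0)
    · filter_upwards [hme, hmW, hke] with τ h1 h2 h3
      refine Prod.ext ?_ ?_
      · change χ (N.anchor z) - χ (Γ.src (ρ (m τ, g)))
          = χ (N.anchor z) - χ (Γ.src g) + τ • w₁
        rw [hρ1 _ h2, hmdef]
        simp only
        rw [h1.2, smul_neg]
        abel
      · change ξ (ξ.symm _) - ξ (A (z, γ τ)) = ξ y - ξ (A (z, g)) + τ • w₂
        have h4 : ξ (ξ.symm (ξ (A (z, γ τ)) + (ξ y - ξ (A (z, g)) + τ • w₂)))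
          = ξ (A (z, γ τ)) + (ξ y - ξ (A (z, g)) + τ • w₂) := h3.2
        rw [h4]
        abel
  · rintro ⟨g, z, y⟩ ⟨⟨⟨⟨hg, hz⟩, hy⟩, hgW⟩, hzg, hAs⟩
    rw [N.mem_arrowsOf_diagonal, Prod.mk_eq_zero, sub_eq_zero, sub_eq_zero,
      χ.injOn.eq_iff hz hg, ξ.injOn.eq_iff hy hAs]
    refine and_congr_right fun h => ?_
    change N.act z g = y ↔ y = A (z, g)
    rw [hA1 z g hzg h, eq_comm]

theorem RightModule.isLieSubgroupoid_arrowsOf_diagonal (hΓ : Γ.IsLie I J) (hN : N.IsSmooth I J K) :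
    (Γ.prod (pair Z)).IsLieSubgroupoid (I.prod (K.prod K)) (J.prod K)
      (N.hat.arrowsOf (diagonal Z)) (range fun z => (N.anchor z, z)) := by
  refine
    { objects := isEmbeddedSubmanifold_graph hN.anchor
      arrows := N.isEmbeddedSubmanifold_arrowsOf_diagonal hΓ hN
      src_mem := fun r hr => N.mem_range_graph.2 (N.mem_arrowsOf_diagonal.1 hr).1
      tgt_mem := fun r hr => N.mem_range_graph.2 ?_
      unit_mem := fun m hm => N.mem_arrowsOf_diagonal.2 ?_
      inv_mem := fun r hr => N.mem_arrowsOf_diagonal.2 ?_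
      mul_mem := fun r hr r' hr' h => N.mem_arrowsOf_diagonal.2 ?_
      submersion := ?_ }
  · obtain ⟨h1, h2⟩ := N.mem_arrowsOf_diagonal.1 hr
    change N.anchor r.2.2 = Γ.tgt r.1
    rw [← h2, N.anchor_act _ _ h1]
  · have h1 := N.mem_range_graph.1 hm
    refine ⟨h1.trans (Γ.src_unit _).symm, ?_⟩
    change N.act m.2 (Γ.unit m.1) = m.2
    rw [← h1, N.act_unit]
  · obtain ⟨h1, h2⟩ := N.mem_arrowsOf_diagonal.1 hr
    change N.anchor r.2.2 = Γ.src (Γ.inv r.1) ∧ N.act r.2.2 (Γ.inv r.1) = r.2.1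
    rw [← h2, N.act_act_inv h1, N.anchor_act _ _ h1, Γ.src_inv]
    exact ⟨rfl, rfl⟩
  · obtain ⟨h1, h2⟩ := N.mem_arrowsOf_diagonal.1 hr
    obtain ⟨h1', h2'⟩ := N.mem_arrowsOf_diagonal.1 hr'
    obtain ⟨h3, h4⟩ := Prod.ext_iff.1 h
    change Γ.tgt r.1 = Γ.src r'.1 at h3
    change r.2.2 = r'.2.1 at h4
    change N.anchor r.2.1 = Γ.src (Γ.mul r.1 r'.1) ∧ N.act r.2.1 (Γ.mul r.1 r'.1) = r'.2.2
    rw [Γ.src_mul _ _ h3, N.act_mul _ _ _ h1 h3, h2, h4]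
    exact ⟨h1, h2'⟩
  · rintro ⟨g, z, y⟩ hr v ⟨c, hc0, hc, hcL, hcv⟩
    obtain ⟨h1, h2⟩ := N.mem_arrowsOf_diagonal.1 hr
    change N.anchor z = Γ.src g at h1
    change N.act z g = y at h2
    change c 0 = (Γ.src g, z) at hc0
    -- A path `(φ (d τ), d τ)` in `L` lifts to `R` as `(γ τ, (d τ, d τ · γ τ))`, where `γ` is
    -- obtained from a local section of `s` through `g`.
    obtain ⟨V, hV, hgV, σ, hσ, hσg, hσs⟩ := (hΓ.src.isSubmersionAt g).exists_section
    have hd : ContMDiffAt 𝓘(𝕜, 𝕜) K ∞ (fun τ => (c τ).2) 0 := contMDiffAt_snd.comp _ hc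
    have hφd : ContMDiffAt 𝓘(𝕜, 𝕜) J ∞ (fun τ => N.anchor (c τ).2) 0 :=
      hN.anchor.contMDiffAt.comp _ hd
    have hφV : ∀ᶠ τ in 𝓝 (0 : 𝕜), N.anchor (c τ).2 ∈ V :=
      hφd.continuousAt.preimage_mem_nhds (hV.mem_nhds (by rw [hc0]; rwa [h1]))
    let γ : 𝕜 → G := fun τ => σ (N.anchor (c τ).2)
    have hγ : ContMDiffAt 𝓘(𝕜, 𝕜) I ∞ γ 0 := hσ.comp_path hφd hφV
    have hγs : ∀ᶠ τ in 𝓝 (0 : 𝕜), N.anchor (c τ).2 = Γ.src (γ τ) :=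
      hφV.mono fun τ hτ => (hσs _ hτ).symm
    have hγ0 : γ 0 = g := by
      change σ (N.anchor (c 0).2) = g
      rw [hc0, h1, hσg]
    let ρ : 𝕜 → G × (Z × Z) := fun τ => (γ τ, ((c τ).2, N.act (c τ).2 (γ τ)))
    have hρ : ContMDiffAt 𝓘(𝕜, 𝕜) (I.prod (K.prod K)) ∞ ρ 0 :=
      hγ.prodMk (hd.prodMk (hN.act.comp_path (hd.prodMk hγ) hγs))
    have hρ0 : ρ 0 = (g, (z, y)) := by
      change (γ 0, ((c 0).2, N.act (c 0).2 (γ 0))) = _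
      rw [hγ0, hc0, h2]
    refine ⟨_, ⟨ρ, hρ0, hρ, ?_, rfl⟩, ?_⟩
    · exact hγs.mono fun τ hτ => N.mem_arrowsOf_diagonal.2 ⟨hτ, rfl⟩
    · have hs : MDifferentiableAt (I.prod (K.prod K)) (J.prod K) (Γ.prod (pair Z)).src
          (g, (z, y)) :=
        ((hΓ.src.contMDiff.prodMap contMDiff_fst).mdifferentiable (by simp)) _
      refine (velocity_comp hρ0 hs hρ).symm.trans (Eq.trans ?_ hcv)
      refine velocity_congr ?_
      filter_upwards [hγs, hcL] with τ h3 h4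
      refine Prod.ext ?_ rfl
      exact h3.symm.trans (N.mem_range_graph.1 h4)

theorem RightModule.IsEquivariantResolution.isFullSubgroupoidIn_arrowsOf_diagonal [Nonempty Z]
    (hΓ : Γ.IsLie I J) (hS : IsEmbeddedSubmanifold J S) (hN : N.IsEquivariantResolution I J K S) :
    (Γ.prod (pair Z)).IsFullSubgroupoidIn (I.prod (K.prod K)) (J.prod K)
      (N.hat.arrowsOf (diagonal Z)) (range fun z => (N.anchor z, z)) (S ×ˢ univ) := by
  obtain ⟨hNs, -, hd, hbij, -, hinv⟩ := hN
  have hφ := hNs.anchor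
  have hopen : IsOpen (N.anchor ⁻¹' S) :=
    (hS.isLocallyClosed.preimage hφ.continuous).isOpen_of_dense hd
  refine ⟨⟨N.isLieSubgroupoid_arrowsOf_diagonal hΓ hNs, N.dense_graph_inter hφ.continuous hd,
    ?_, ?_⟩, ?_⟩
  · rintro _ ⟨⟨z, rfl⟩, hzS, -⟩ v
    have hφz : MDifferentiableAt K J N.anchor z := hφ.mdifferentiable (by simp) z
    constructor
    · rintro ⟨c, hc0, hc, hcS, hcv⟩
      have hc1 : ContMDiffAt 𝓘(𝕜, 𝕜) J ∞ (fun τ => (c τ).1) 0 := contMDiffAt_fst.comp _ hc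
      have hc2 : ContMDiffAt 𝓘(𝕜, 𝕜) K ∞ (fun τ => (c τ).2) 0 := contMDiffAt_snd.comp _ hc
      have hl := hbij.injOn.leftInvOn_invFunOn
      have hS1 : ∀ᶠ τ in 𝓝 (0 : 𝕜), (c τ).1 ∈ S := hcS.mono fun τ hτ => hτ.1
      let d : 𝕜 → Z := fun τ => Function.invFunOn N.anchor (N.anchor ⁻¹' S) (c τ).1
      -- The component in `S` lifts to a path `d` in `Z`, as `φ` is a diffeomorphism over `S`. The
      -- velocity then splits as `(0, c₂' - d') + ((φ ∘ d)', d')`.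
      have hd : ContMDiffAt 𝓘(𝕜, 𝕜) K ∞ d 0 := (hinv _ hl).comp_path hc1 hS1
      have hd0 : d 0 = z := by
        change Function.invFunOn _ _ (c 0).1 = z
        rw [hc0]
        exact hl hzS
      have hφd : ∀ᶠ τ in 𝓝 (0 : 𝕜), (c τ).1 = N.anchor (d τ) := hS1.mono fun τ hτ =>
        (Function.invFunOn_eq (hbij.surjOn hτ)).symm
      have hφdc : ContMDiffAt 𝓘(𝕜, 𝕜) J ∞ (fun τ => N.anchor (d τ)) 0 :=
        hφ.contMDiffAt.comp _ hd
      have hv : v = ((velocity J fun τ => N.anchor (d τ)), velocity K fun τ => (c τ).2) := by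
        rw [← velocity_congr hφd]
        exact hcv.symm.trans (velocity_prodMk hc1 hc2)
      obtain ⟨k, hk0, hk, hkv⟩ := exists_path_of_tangentVector (I := K) z
        (velocity K (fun τ => (c τ).2) - velocity K d : E₃)
      refine ⟨((0, (velocity K (fun τ => (c τ).2) - velocity K d : E₃)) : E₂ × E₃),
        ⟨fun τ => (Γ.unit (N.anchor z), (z, k τ)), ?_,
          contMDiffAt_const.prodMk (contMDiffAt_const.prodMk hk),
          Eventually.of_forall fun τ => Prod.ext (Γ.src_unit _) rfl, ?_⟩,
        (((velocity J fun τ => N.anchor (d τ)), velocity K d) : E₂ × E₃),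
        ⟨fun τ => (N.anchor (d τ), d τ), ?_, hφdc.prodMk hd,
          Eventually.of_forall fun τ => mem_range_self (d τ), velocity_prodMk hφdc hd⟩, ?_⟩
      · exact Prod.ext rfl (Prod.ext rfl hk0)
      · refine (velocity_prodMk (I := J) (c := fun _ => Γ.tgt (Γ.unit (N.anchor z)))
          contMDiffAt_const hk).trans (Prod.ext (velocity_const _) hkv)
      · change (N.anchor (d 0), d 0) = _
        rw [hd0]
      · rw [hv]
        exact Prod.ext (zero_add _).symm (sub_add_cancel _ _).symm
    · rintro ⟨_, ⟨e, he0, he, hes, rfl⟩, _, ⟨d, hd0, hd, hdL, rfl⟩, rfl⟩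
      have he1 : ContMDiffAt 𝓘(𝕜, 𝕜) I ∞ (fun τ => (e τ).1) 0 := contMDiffAt_fst.comp _ he
      have he2 : ContMDiffAt 𝓘(𝕜, 𝕜) K ∞ (fun τ => (e τ).2.2) 0 :=
        contMDiffAt_snd.comp _ (contMDiffAt_snd.comp _ he)
      have hd2 : ContMDiffAt 𝓘(𝕜, 𝕜) K ∞ (fun τ => (d τ).2) 0 := contMDiffAt_snd.comp _ hd
      have hes1 : ∀ᶠ τ in 𝓝 (0 : 𝕜), N.anchor z = Γ.src (e τ).1 :=
        hes.mono fun τ hτ => (congrArg Prod.fst hτ).symm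
      let p : 𝕜 → Z := fun τ => N.act z (e τ).1
      have hp : ContMDiffAt 𝓘(𝕜, 𝕜) K ∞ p 0 :=
        hNs.act.comp_path (contMDiffAt_const.prodMk he1) hes1
      have hp0 : p 0 = z := by
        change N.act z (e 0).1 = z
        rw [he0]
        exact N.act_unit z
      -- The target of `e₁` is `φ (z · e₁)`. So both summands have first component in the image of
      -- `dφ`, and the sum is realized by `φ ∘ k` for a path `k` in `Z`.
      have hpφ : ∀ᶠ τ in 𝓝 (0 : 𝕜), Γ.tgt (e τ).1 = N.anchor (p τ) :=
        hes1.mono fun τ hτ => (N.anchor_act _ _ hτ).symm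
      have hdφ : ∀ᶠ τ in 𝓝 (0 : 𝕜), (d τ).1 = N.anchor (d τ).2 :=
        hdL.mono fun τ hτ => (N.mem_range_graph.1 hτ).symm
      have hd20 : (d 0).2 = z := by rw [hd0]
      have ha : velocity (J.prod K) (fun τ => (Γ.prod (pair Z)).tgt (e τ))
          = ((mfderiv K J N.anchor z (velocity K p : E₃) : E₂),
            velocity K fun τ => (e τ).2.2) := by
        refine (velocity_prodMk (hΓ.tgt.contMDiff.contMDiffAt.comp _ he1) he2).trans
          (Prod.ext ?_ rfl)
        exact (velocity_congr hpφ).trans (velocity_comp hp0 hφz hp)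
      have hb : velocity (J.prod K) d
          = ((mfderiv K J N.anchor z (velocity K (fun τ => (d τ).2) : E₃) : E₂),
            velocity K fun τ => (d τ).2) := by
        refine (velocity_prodMk (contMDiffAt_fst.comp _ hd) hd2).trans (Prod.ext ?_ rfl)
        exact (velocity_congr hdφ).trans (velocity_comp hd20 hφz hd2)
      obtain ⟨k, hk0, hk, hkv⟩ := exists_path_of_tangentVector (I := K) z
        (velocity K p + velocity K (fun τ => (d τ).2) : E₃)
      obtain ⟨l, hl0, hl, hlv⟩ := exists_path_of_tangentVector (I := K) z
        (velocity K (fun τ => (e τ).2.2) + velocity K (fun τ => (d τ).2) : E₃)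
      have hφk : ContMDiffAt 𝓘(𝕜, 𝕜) J ∞ (fun τ => N.anchor (k τ)) 0 :=
        hφ.contMDiffAt.comp _ hk
      refine ⟨fun τ => (N.anchor (k τ), l τ), ?_, hφk.prodMk hl, ?_, ?_⟩
      · change (N.anchor (k 0), l 0) = _
        rw [hk0, hl0]
      -- The path `k` remains in `φ ⁻¹ S` for small times because this set is open.
      · filter_upwards [hk.continuousAt.preimage_mem_nhds
          (hopen.mem_nhds (by rw [hk0]; exact hzS))] with τ hτ
        exact ⟨hτ, mem_univ _⟩
      · refine (velocity_prodMk hφk hl).trans ?_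
        refine Eq.trans ?_ (congrArg₂ (fun a b : E₂ × E₃ => a + b) ha hb).symm
        refine Prod.ext ?_ hlv
        refine (velocity_comp hk0 hφz hk).trans ?_
        exact (congrArg (mfderiv K J N.anchor z) hkv).trans (map_add _ _ _)
  · rintro ⟨m, z⟩ ⟨hm, -⟩
    obtain ⟨y, -, rfl⟩ := hbij.surjOn hm
    exact ⟨(Γ.unit (N.anchor y), (z, y)), Prod.ext (Γ.src_unit _) rfl,
      ⟨y, Prod.ext (Γ.tgt_unit _).symm rfl⟩⟩
  · rintro ⟨g, z, y⟩ ⟨hL, hS, -⟩ ⟨hL', hS', -⟩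
    have h1 : N.anchor z = Γ.src g := N.mem_range_graph.1 hL
    have h2 : N.anchor y = Γ.tgt g := N.mem_range_graph.1 hL'
    have h3 := N.anchor_act _ _ h1
    -- Both `z · g` and `y` lie over `tgt g ∈ S`, where `φ` is injective.
    refine N.mem_arrowsOf_diagonal.2 ⟨h1, hbij.injOn ?_ ?_ (h3.trans h2.symm)⟩
    · change N.anchor (N.act z g) ∈ S
      rw [h3]
      exact hS'
    · change N.anchor y ∈ S
      rw [h2]
      exact hS'

end

end SetGroupoid

namespace SetGroupoid

/-! ## The quotients -/

section

variable {𝕜 : Type*} [RCLike 𝕜]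
  {E₁ H₁ G : Type*} [NormedAddCommGroup E₁] [NormedSpace 𝕜 E₁] [TopologicalSpace H₁]
  [TopologicalSpace G] [ChartedSpace H₁ G]
  {E₂ H₂ M : Type*} [NormedAddCommGroup E₂] [NormedSpace 𝕜 E₂] [TopologicalSpace H₂]
  [TopologicalSpace M] [ChartedSpace H₂ M]
  {E₃ H₃ Z : Type*} [NormedAddCommGroup E₃] [NormedSpace 𝕜 E₃] [TopologicalSpace H₃]
  [TopologicalSpace Z] [ChartedSpace H₃ Z]
  {E₄ H₄ W : Type*} [NormedAddCommGroup E₄] [NormedSpace 𝕜 E₄] [TopologicalSpace H₄]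
  [TopologicalSpace W] [ChartedSpace H₄ W]
  {I : ModelWithCorners 𝕜 E₁ H₁} {J : ModelWithCorners 𝕜 E₂ H₂} {K : ModelWithCorners 𝕜 E₃ H₃}
  {K' : ModelWithCorners 𝕜 E₄ H₄} {Γ : SetGroupoid G M} {N : Γ.RightModule Z} {S : Set M}

/-- All conditions are transported by the diffeomorphism; it makes `Z(R)` and its image under `X⁻¹`
resolutions once they coincide with known ones. -/
theorem RightModule.Coincide.isEquivariantResolution {N' : Γ.RightModule W}
    (h : N'.Coincide K' N K) (hN : N.IsEquivariantResolution I J K S) :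
    N'.IsEquivariantResolution I J K' S := by
  obtain ⟨Φ, hΦ, hΦact⟩ := h
  obtain ⟨⟨hφ, hact⟩, -, hd, hbij, -, hinv⟩ := hN
  have hanchor : ContMDiff K' J ∞ N'.anchor := (hφ.comp Φ.contMDiff).congr fun w => (hΦ w).symm
  have hpre : N'.anchor ⁻¹' S = Φ ⁻¹' (N.anchor ⁻¹' S) := by
    ext w
    rw [mem_preimage, mem_preimage, mem_preimage, hΦ]
  refine ⟨⟨hanchor, ?_⟩, hanchor, ?_, ⟨fun w hw => hw, ?_, ?_⟩, hanchor.contMDiffOn, ?_⟩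
  · have h1 : ContMDiff (K'.prod I) (K.prod I) ∞ fun q : W × G => (Φ q.1, q.2) :=
      Φ.contMDiff.prodMap contMDiff_id
    have h2 : ∀ q : W × G, N'.anchor q.1 = Γ.src q.2 → N.anchor (Φ q.1) = Γ.src q.2 :=
      fun q hq => (hΦ q.1).trans hq
    refine (Φ.symm.contMDiff.comp_contMDiffOn
      (hact.comp h1.contMDiffOn fun q hq => h2 q hq)).congr fun q hq => ?_
    change _ = Φ.symm (N.act (Φ q.1) q.2)
    rw [← hΦact _ _ hq, Φ.symm_apply_apply]
  · rw [hpre]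
    exact hd.preimage Φ.toHomeomorph.isOpenMap
  · intro a ha b hb e
    rw [hpre] at ha hb
    refine Φ.injective (hbij.injOn ha hb ((hΦ a).trans (e.trans (hΦ b).symm)))
  · intro m hm
    obtain ⟨z, hz, rfl⟩ := hbij.surjOn hm
    have h1 : N'.anchor (Φ.symm z) = N.anchor z := by rw [← hΦ, Φ.apply_symm_apply]
    exact ⟨Φ.symm z, by rwa [mem_preimage, h1], h1⟩
  · intro g hg
    have h1 : LeftInvOn (fun m => Φ (g m)) N.anchor (N.anchor ⁻¹' S) := fun z hz => by
      have h2 : N'.anchor (Φ.symm z) = N.anchor z := by rw [← hΦ, Φ.apply_symm_apply]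
      have h3 := hg (x := Φ.symm z) (by rwa [mem_preimage, h2])
      rw [h2] at h3
      change Φ (g (N.anchor z)) = z
      rw [h3, Φ.apply_symm_apply]
    refine (Φ.symm.contMDiff.comp_contMDiffOn (hinv _ h1)).congr fun m _ => ?_
    exact (Φ.symm_apply_apply (g m)).symm

/-! ### The three quotients as spaces of fibres of explicit maps -/

variable [I.Boundaryless] [IsManifold I ∞ G] [IsManifold J ∞ M] [IsManifold K ∞ Z]
  [T2Space Z] [SecondCountableTopology Z]

/-- `X (Z, φ)` is a manifold, and it is `(Z × Z, φ × id)`. -/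
theorem exists_induced_naturalBimodule (hΓ : Γ.IsLie I J) (hN : N.IsSmooth I J K) :
    ∃ _ : ChartedSpace (ModelProd H₃ H₃) ((Γ.naturalBimodule Z).Induced N),
      IsQuotientManifold (K.prod (I.prod K)) (K.prod K) ((Γ.naturalBimodule Z).fibre N)
        ((Γ.naturalBimodule Z).rel N) ∧
      ((Γ.naturalBimodule Z).induced N).Coincide (K.prod K) N.hat (K.prod K) := by
  let q : (Γ.naturalBimodule Z).fibre N → Z × Z := fun p => (N.act p.1.1 p.1.2.1, p.1.2.2)
  have hP : ∀ p : (Γ.naturalBimodule Z).fibre N, N.anchor p.1.1 = Γ.src p.1.2.1 := fun p => p.2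
  refine (exists_isQuotientManifold (K.prod (I.prod K)) (K.prod K)
    (r := (Γ.naturalBimodule Z).rel N) q ?_ ?_ ?_ ?_ ?_).elim ?_
  · rintro ⟨⟨z, γ, w⟩, (hz : N.anchor z = Γ.src γ)⟩ ⟨p, hp⟩ ⟨g, hg, rfl⟩
    change Γ.tgt g = N.anchor z at hg
    have h1 : Γ.tgt g = Γ.src γ := hg.trans hz
    refine Prod.ext ?_ rfl
    change N.act z γ = N.act (N.act z (Γ.inv g)) (Γ.mul g γ)
    rw [← N.act_mul _ _ _ (by rw [Γ.src_inv, hg])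
      (by rw [Γ.tgt_inv, Γ.src_mul _ _ h1]), Γ.inv_mul_mul h1]
  · rintro ⟨⟨z, γ, w⟩, (hz : N.anchor z = Γ.src γ)⟩ ⟨⟨z', γ', w'⟩, (hz' : N.anchor z' = Γ.src γ')⟩ h
    obtain ⟨h1, h2⟩ := Prod.ext_iff.1 h
    change N.act z γ = N.act z' γ' at h1
    change w = w' at h2
    have h3 : Γ.tgt γ' = Γ.tgt γ := by
      rw [← N.anchor_act _ _ hz, ← N.anchor_act _ _ hz', h1]
    have h4 : Γ.tgt γ' = Γ.src (Γ.inv γ) := by rw [Γ.src_inv, h3]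
    -- From `z · γ = z' · γ'` follow `tgt γ = tgt γ'` and `z' = z · (γ' γ⁻¹)⁻¹`.
    refine ⟨Γ.mul γ' (Γ.inv γ), ?_, Prod.ext ?_ (Prod.ext ?_ h2.symm)⟩
    · rw [Γ.tgt_mul _ _ h4, Γ.tgt_inv]
      exact hz.symm
    · change z' = N.act z (Γ.inv (Γ.mul γ' (Γ.inv γ)))
      rw [Γ.inv_mul_rev h4, Γ.inv_inv, N.act_mul _ _ _ hz (by rw [Γ.src_inv, h3]), h1,
        N.act_act_inv hz']
    · exact (Γ.mul_inv_mul h3).symm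
  · rintro ⟨a, b⟩
    exact ⟨⟨(a, (Γ.unit (N.anchor a), b)), (Γ.src_unit _).symm⟩, Prod.ext (N.act_unit a) rfl⟩
  · rintro ⟨⟨z, γ, w⟩, (hz : N.anchor z = Γ.src γ)⟩
    obtain ⟨U, hU, hzU, A, hA, hAN⟩ := hN.exists_extension hΓ hz
    have h1 : ContMDiff (K.prod (I.prod K)) (K.prod I) ∞ fun p : Z × (G × Z) => (p.1, p.2.1) :=
      contMDiff_fst.prodMk (contMDiff_fst.comp contMDiff_snd)
    have h2 : ContMDiff (K.prod (I.prod K)) K ∞ fun p : Z × (G × Z) => p.2.2 :=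
      contMDiff_snd.comp contMDiff_snd
    exact ⟨_, hU.preimage h1.continuous, hzU, fun p => (A (p.1, p.2.1), p.2.2),
      (hA.comp h1.contMDiffOn fun p hp => hp).prodMk h2.contMDiffOn,
      fun p hp => Prod.ext (hAN _ _ hp (hP p)) rfl⟩
  · rintro ⟨⟨z, γ, w⟩, (hz : N.anchor z = Γ.src γ)⟩
    obtain ⟨V, hV, hγV, σ, hσ, hσγ, hσt⟩ := (hΓ.tgt.isSubmersionAt γ).exists_section
    have h1 : ContMDiff (K.prod K) J ∞ fun p : Z × Z => N.anchor p.1 :=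
      hN.anchor.comp contMDiff_fst
    have h2 : ContMDiffOn (K.prod K) I ∞ (fun p : Z × Z => σ (N.anchor p.1))
        ((fun p : Z × Z => N.anchor p.1) ⁻¹' V) := hσ.comp h1.contMDiffOn fun p hp => hp
    have hs : ∀ p : Z × Z, N.anchor p.1 ∈ V →
        N.anchor p.1 = Γ.src (Γ.inv (σ (N.anchor p.1))) := fun p hp => by
      rw [Γ.src_inv, hσt _ hp]
    -- With a local section `σ` of `t`, a point `(a, b)` lifts to `a · σ⁻¹` paired with the arrow `σ
    -- = σ (φ a)`, whose product is `a` again.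
    refine ⟨_, hV.preimage h1.continuous, ?_, fun p => (N.act p.1 (Γ.inv (σ (N.anchor p.1))),
      (σ (N.anchor p.1), p.2)), ?_, ?_, ?_⟩
    · change N.anchor (N.act z γ) ∈ V
      rwa [N.anchor_act _ _ hz]
    · exact (hN.act.comp (contMDiff_fst.contMDiffOn.prodMk (hΓ.inv.comp_contMDiffOn h2))
        fun p hp => hs p hp).prodMk (h2.prodMk contMDiff_snd.contMDiffOn)
    · change (N.act (N.act z γ) (Γ.inv (σ (N.anchor (N.act z γ)))),
        (σ (N.anchor (N.act z γ)), w)) = (z, γ, w)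
      rw [N.anchor_act _ _ hz, hσγ, N.act_act_inv hz]
    · rintro ⟨a, b⟩ hp
      have h3 : Γ.tgt (σ (N.anchor a)) = N.anchor a := hσt _ hp
      refine ⟨?_, Prod.ext (N.act_inv_act h3.symm) rfl⟩
      change N.anchor (N.act a _) = Γ.src (σ (N.anchor a))
      rw [N.anchor_act _ _ (hs (a, b) hp), Γ.tgt_inv]
  · rintro C ⟨hC, Φ, hΦ⟩
    refine ⟨C, hC, Φ, ?_, ?_⟩
    · rintro ⟨p⟩
      rw [hΦ]
      exact Prod.ext (N.anchor_act _ _ (hP p)) rfl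
    · rintro ⟨p⟩ g h
      have h1 : (Γ.tgt p.1.2.1, p.1.2.2) = (Γ.src g.1, g.2.1) := h
      obtain ⟨h2, -⟩ := Prod.ext_iff.1 h1
      have h3 : ((Γ.naturalBimodule Z).right.anchor p.1.2) = (Γ.prod (pair Z)).src g := h
      -- Composability selects the meaningful branch of the total action.
      simp only [Bimodule.induced, h3, dif_pos]
      rw [hΦ, hΦ]
      exact Prod.ext (N.act_mul _ _ _ (hP p) h2) rfl

/-- `Z(R)` is a manifold, and it is `(Z × Z, φ × id)`. -/
theorem exists_zModule_arrowsOf_diagonal (hΓ : Γ.IsLie I J) (hN : N.IsSmooth I J K) :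
    ∃ _ : ChartedSpace (ModelProd H₃ H₃) ((Γ.prod (pair Z)).ZQuot (N.hat.arrowsOf (diagonal Z))
        (range fun z => (N.anchor z, z))),
      IsQuotientManifold (I.prod (K.prod K)) (K.prod K)
        ((Γ.prod (pair Z)).src ⁻¹' (range fun z => (N.anchor z, z)))
        ((Γ.prod (pair Z)).subRel (N.hat.arrowsOf (diagonal Z))
          (range fun z => (N.anchor z, z))) ∧
      ((Γ.prod (pair Z)).ZModule (N.hat.arrowsOf (diagonal Z))
        (range fun z => (N.anchor z, z))).Coincide (K.prod K) N.hat (K.prod K) := by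
  let q : (Γ.prod (pair Z)).src ⁻¹' (range fun z => (N.anchor z, z)) → Z × Z :=
    fun p => (N.act p.1.2.1 p.1.1, p.1.2.2)
  have hP : ∀ p : (Γ.prod (pair Z)).src ⁻¹' (range fun z => (N.anchor z, z)),
      N.anchor p.1.2.1 = Γ.src p.1.1 := fun p => N.mem_range_graph.1 p.2
  refine (exists_isQuotientManifold (I.prod (K.prod K)) (K.prod K)
    (r := (Γ.prod (pair Z)).subRel (N.hat.arrowsOf (diagonal Z))
          (range fun z => (N.anchor z, z))) q ?_ ?_ ?_ ?_ ?_).elim ?_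
  · rintro ⟨⟨γ, z, w⟩, hp⟩ ⟨p', hp'⟩ ⟨⟨g, y, y'⟩, hg, ht, rfl⟩
    obtain ⟨h1, h2⟩ := N.mem_arrowsOf_diagonal.1 hg
    obtain ⟨h3, h4⟩ := Prod.ext_iff.1 ht
    change N.anchor y = Γ.src g at h1
    change N.act y g = y' at h2
    change Γ.tgt g = Γ.src γ at h3
    change y' = z at h4
    refine Prod.ext ?_ rfl
    change N.act z γ = N.act y (Γ.mul g γ)
    rw [N.act_mul _ _ _ h1 h3, h2, h4]
  · rintro ⟨⟨γ, z, w⟩, hp⟩ ⟨⟨γ', z', w'⟩, hp'⟩ h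
    have hz : N.anchor z = Γ.src γ := N.mem_range_graph.1 hp
    have hz' : N.anchor z' = Γ.src γ' := N.mem_range_graph.1 hp'
    obtain ⟨h1, h2⟩ := Prod.ext_iff.1 h
    change N.act z γ = N.act z' γ' at h1
    change w = w' at h2
    have h3 : Γ.tgt γ' = Γ.tgt γ := by
      rw [← N.anchor_act _ _ hz, ← N.anchor_act _ _ hz', h1]
    have h4 : Γ.tgt γ' = Γ.src (Γ.inv γ) := by rw [Γ.src_inv, h3]
    -- The component in `Γ` is the quotient of the two arrows; the component `(z', z)` is forced by
    -- the base points.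
    refine ⟨(Γ.mul γ' (Γ.inv γ), (z', z)), N.mem_arrowsOf_diagonal.2 ⟨?_, ?_⟩,
      Prod.ext ?_ rfl, Prod.ext (Γ.mul_inv_mul h3).symm (Prod.ext rfl h2.symm)⟩
    · change N.anchor z' = Γ.src (Γ.mul γ' (Γ.inv γ))
      rw [Γ.src_mul _ _ h4, hz']
    · change N.act z' (Γ.mul γ' (Γ.inv γ)) = z
      rw [N.act_mul _ _ _ hz' h4, ← h1, N.act_act_inv hz]
    · change Γ.tgt (Γ.mul γ' (Γ.inv γ)) = Γ.src γ
      rw [Γ.tgt_mul _ _ h4, Γ.tgt_inv]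
  · rintro ⟨a, b⟩
    exact ⟨⟨(Γ.unit (N.anchor a), (a, b)), N.mem_range_graph.2 (Γ.src_unit _).symm⟩,
      Prod.ext (N.act_unit a) rfl⟩
  · rintro ⟨⟨γ, z, w⟩, hp⟩
    have hz : N.anchor z = Γ.src γ := N.mem_range_graph.1 hp
    obtain ⟨U, hU, hzU, A, hA, hAN⟩ := hN.exists_extension hΓ hz
    have h1 : ContMDiff (I.prod (K.prod K)) (K.prod I) ∞ fun p : G × (Z × Z) => (p.2.1, p.1) :=
      (contMDiff_fst.comp contMDiff_snd).prodMk contMDiff_fst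
    have h2 : ContMDiff (I.prod (K.prod K)) K ∞ fun p : G × (Z × Z) => p.2.2 :=
      contMDiff_snd.comp contMDiff_snd
    exact ⟨_, hU.preimage h1.continuous, hzU, fun p => (A (p.2.1, p.1), p.2.2),
      (hA.comp h1.contMDiffOn fun p hp => hp).prodMk h2.contMDiffOn,
      fun p hp => Prod.ext (hAN _ _ hp (hP p)) rfl⟩
  · rintro ⟨⟨γ, z, w⟩, hp⟩
    have hz : N.anchor z = Γ.src γ := N.mem_range_graph.1 hp
    obtain ⟨V, hV, hγV, σ, hσ, hσγ, hσt⟩ := (hΓ.tgt.isSubmersionAt γ).exists_section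
    have h1 : ContMDiff (K.prod K) J ∞ fun p : Z × Z => N.anchor p.1 :=
      hN.anchor.comp contMDiff_fst
    have h2 : ContMDiffOn (K.prod K) I ∞ (fun p : Z × Z => σ (N.anchor p.1))
        ((fun p : Z × Z => N.anchor p.1) ⁻¹' V) := hσ.comp h1.contMDiffOn fun p hp => hp
    have hs : ∀ p : Z × Z, N.anchor p.1 ∈ V →
        N.anchor p.1 = Γ.src (Γ.inv (σ (N.anchor p.1))) := fun p hp => by
      rw [Γ.src_inv, hσt _ hp]
    refine ⟨_, hV.preimage h1.continuous, ?_, fun p => (σ (N.anchor p.1),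
      (N.act p.1 (Γ.inv (σ (N.anchor p.1))), p.2)), ?_, ?_, ?_⟩
    · change N.anchor (N.act z γ) ∈ V
      rwa [N.anchor_act _ _ hz]
    · exact h2.prodMk ((hN.act.comp (contMDiff_fst.contMDiffOn.prodMk
        (hΓ.inv.comp_contMDiffOn h2)) fun p hp => hs p hp).prodMk contMDiff_snd.contMDiffOn)
    · change (σ (N.anchor (N.act z γ)),
        (N.act (N.act z γ) (Γ.inv (σ (N.anchor (N.act z γ)))), w)) = (γ, z, w)
      rw [N.anchor_act _ _ hz, hσγ, N.act_act_inv hz]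
    · rintro ⟨a, b⟩ hp
      have h3 : Γ.tgt (σ (N.anchor a)) = N.anchor a := hσt _ hp
      refine ⟨N.mem_range_graph.2 ?_, Prod.ext (N.act_inv_act h3.symm) rfl⟩
      change N.anchor (N.act a _) = Γ.src (σ (N.anchor a))
      rw [N.anchor_act _ _ (hs (a, b) hp), Γ.tgt_inv]
  · rintro C ⟨hC, Φ, hΦ⟩
    refine ⟨C, hC, Φ, ?_, ?_⟩
    · rintro ⟨p⟩
      rw [hΦ]
      exact Prod.ext (N.anchor_act _ _ (hP p)) rfl
    · rintro ⟨p⟩ g h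
      have h1 : (Γ.tgt p.1.1, p.1.2.2) = (Γ.src g.1, g.2.1) := h
      obtain ⟨h2, -⟩ := Prod.ext_iff.1 h1
      have h3 : (Γ.prod (pair Z)).tgt p.1 = (Γ.prod (pair Z)).src g := h
      simp only [ZModule, h3, dif_pos]
      rw [hΦ, hΦ]
      exact Prod.ext (N.act_mul _ _ _ (hP p) h2) rfl

/-- `X⁻¹ (Z × Z, φ × id)` is a manifold, and it is `(Z, φ)`. -/
theorem exists_induced_inverse_naturalBimodule (hΓ : Γ.IsLie I J) (hN : N.IsSmooth I J K)
    {N' : (Γ.prod (pair Z)).RightModule W} (h : N'.Coincide K' N.hat (K.prod K)) :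
    ∃ _ : ChartedSpace H₃ ((Γ.naturalBimodule Z).inverse.Induced N'),
      IsQuotientManifold (K'.prod (I.prod K)) K ((Γ.naturalBimodule Z).inverse.fibre N')
        ((Γ.naturalBimodule Z).inverse.rel N') ∧
      ((Γ.naturalBimodule Z).inverse.induced N').Coincide K N K := by
  obtain ⟨Ψ, hΨ, hΨact⟩ := h
  -- If `Ψ w = (a, b)` and `(w, (γ, z))` is in the fibre product, then `φ a = tgt γ` and `b = z`.
  -- Thus `b` carries no information beyond `z`, which the pair groupoid changes freely; `a · γ⁻¹`
  -- is the remaining invariant.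
  let q : (Γ.naturalBimodule Z).inverse.fibre N' → Z :=
    fun p => N.act (Ψ p.1.1).1 (Γ.inv p.1.2.1)
  have hP' : ∀ p : W × (G × Z), p ∈ (Γ.naturalBimodule Z).inverse.fibre N' ↔
      N.anchor (Ψ p.1).1 = Γ.tgt p.2.1 ∧ (Ψ p.1).2 = p.2.2 := fun p => by
    change N'.anchor p.1 = (Γ.tgt p.2.1, p.2.2) ↔ _
    rw [← hΨ]
    exact Prod.ext_iff
  have hP : ∀ p : (Γ.naturalBimodule Z).inverse.fibre N',
      N.anchor (Ψ p.1.1).1 = Γ.src (Γ.inv p.1.2.1) := fun p => by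
    rw [Γ.src_inv]
    exact ((hP' p.1).1 p.2).1
  refine (exists_isQuotientManifold (K'.prod (I.prod K)) K
    (r := (Γ.naturalBimodule Z).inverse.rel N') q ?_ ?_ ?_ ?_ ?_).elim ?_
  · rintro ⟨⟨w, γ, z⟩, hp⟩ ⟨p', hp'⟩ ⟨⟨g, y, y'⟩, hg, rfl⟩
    obtain ⟨h1, h2⟩ := (hP' _).1 hp
    have hg' : (Γ.tgt g, y') = N'.anchor w := hg
    have hgs : N'.anchor w = (Γ.prod (pair Z)).src ((Γ.prod (pair Z)).inv (g, (y, y'))) := by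
      rw [(Γ.prod (pair Z)).src_inv]
      exact hg'.symm
    rw [← hΨ] at hg'
    obtain ⟨h3, -⟩ := Prod.ext_iff.1 hg'
    change N.anchor (Ψ w).1 = Γ.tgt γ at h1
    change Γ.tgt g = N.anchor (Ψ w).1 at h3
    change N.act (Ψ w).1 (Γ.inv γ) = N.act (Ψ (N'.act w _)).1 (Γ.inv (Γ.mul γ (Γ.inv g)))
    rw [hΨact _ _ hgs]
    change _ = N.act (N.act (Ψ w).1 (Γ.inv g)) _
    have h4 : Γ.tgt γ = Γ.src (Γ.inv g) := by rw [Γ.src_inv, h3, h1]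
    rw [Γ.inv_mul_rev h4, Γ.inv_inv, N.act_mul _ g (Γ.inv γ)
      (by rw [N.anchor_act _ _ (by rw [h1, h4]), Γ.tgt_inv]) (by rw [Γ.src_inv, h3, h1]),
      N.act_inv_act h3.symm]
  · rintro ⟨⟨w, γ, z⟩, hp⟩ ⟨⟨w', γ', z'⟩, hp'⟩ h
    obtain ⟨h1, h2⟩ := (hP' _).1 hp
    obtain ⟨h1', h2'⟩ := (hP' _).1 hp'
    change N.anchor (Ψ w).1 = Γ.tgt γ at h1
    change N.anchor (Ψ w').1 = Γ.tgt γ' at h1'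
    change (Ψ w).2 = z at h2
    change (Ψ w').2 = z' at h2'
    change N.act (Ψ w).1 (Γ.inv γ) = N.act (Ψ w').1 (Γ.inv γ') at h
    have h3 : Γ.src γ = Γ.src γ' := by
      rw [← Γ.tgt_inv γ, ← N.anchor_act _ _ (h1.trans (Γ.src_inv γ).symm), h,
        N.anchor_act _ _ (h1'.trans (Γ.src_inv γ').symm), Γ.tgt_inv]
    have h4 : Γ.tgt (Γ.inv γ') = Γ.src γ := by rw [Γ.tgt_inv, h3]
    have h5 : Γ.inv (Γ.mul (Γ.inv γ') γ) = Γ.mul (Γ.inv γ) γ' := by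
      rw [Γ.inv_mul_rev h4, Γ.inv_inv]
    have hg : (Γ.prod (pair Z)).tgt (Γ.mul (Γ.inv γ') γ, (z', z)) = N'.anchor w := by
      rw [← hΨ]
      refine Prod.ext ?_ h2.symm
      change Γ.tgt (Γ.mul (Γ.inv γ') γ) = N.anchor (Ψ w).1
      rw [Γ.tgt_mul _ _ h4, h1]
    -- From `a · γ⁻¹ = a' · γ'⁻¹` the arrow `γ'⁻¹ γ` takes `a'` to `a`, and its inverse acts on the
    -- representative.
    refine ⟨(Γ.mul (Γ.inv γ') γ, (z', z)), hg, Prod.ext ?_ (Prod.ext ?_ rfl)⟩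
    · refine Ψ.injective ?_
      change Ψ w' = Ψ (N'.act w _)
      rw [hΨact _ _ (by rw [(Γ.prod (pair Z)).src_inv]; exact hg.symm)]
      refine Prod.ext ?_ h2'
      change (Ψ w').1 = N.act (Ψ w).1 (Γ.inv (Γ.mul (Γ.inv γ') γ))
      rw [h5, N.act_mul _ _ _ (by rw [Γ.src_inv, h1]) (by rw [Γ.tgt_inv, h3]), h,
        N.act_inv_act h1']
    · change γ' = Γ.mul γ (Γ.inv (Γ.mul (Γ.inv γ') γ))
      rw [h5, Γ.mul_inv_mul' h3]
  · intro z
    have h1 : (Ψ (Ψ.symm (z, z))) = (z, z) := Ψ.apply_symm_apply _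
    refine ⟨⟨(Ψ.symm (z, z), (Γ.unit (N.anchor z), z)), (hP' _).2 ?_⟩, ?_⟩
    · change N.anchor (Ψ (Ψ.symm (z, z))).1 = _ ∧ (Ψ (Ψ.symm (z, z))).2 = z
      rw [h1, Γ.tgt_unit]
      exact ⟨rfl, rfl⟩
    · change N.act (Ψ (Ψ.symm (z, z))).1 (Γ.inv (Γ.unit (N.anchor z))) = z
      rw [h1, Γ.inv_unit, N.act_unit]
  · intro p
    obtain ⟨U, hU, hzU, A, hA, hAN⟩ := hN.exists_extension hΓ (hP p)
    have h1 : ContMDiff (K'.prod (I.prod K)) (K.prod I) ∞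
        fun p : W × (G × Z) => ((Ψ p.1).1, Γ.inv p.2.1) :=
      (contMDiff_fst.comp (Ψ.contMDiff.comp contMDiff_fst)).prodMk
        (hΓ.inv.comp (contMDiff_fst.comp contMDiff_snd))
    exact ⟨_, hU.preimage h1.continuous, hzU, fun p => A ((Ψ p.1).1, Γ.inv p.2.1),
      hA.comp h1.contMDiffOn fun p hp => hp, fun p hp => hAN _ _ hp (hP p)⟩
  · rintro ⟨⟨w, γ, z⟩, hp⟩
    obtain ⟨h1, h2⟩ := (hP' _).1 hp
    change N.anchor (Ψ w).1 = Γ.tgt γ at h1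
    change (Ψ w).2 = z at h2
    obtain ⟨V, hV, hγV, σ, hσ, hσγ, hσs⟩ := (hΓ.src.isSubmersionAt γ).exists_section
    have h3 : ContMDiffOn K I ∞ (fun u : Z => σ (N.anchor u)) (N.anchor ⁻¹' V) :=
      hσ.comp hN.anchor.contMDiffOn fun p hp => hp
    have hs : ∀ u : Z, N.anchor u ∈ V → N.anchor u = Γ.src (σ (N.anchor u)) :=
      fun u hu => (hσs _ hu).symm
    have h4 : ContMDiffOn K (K.prod K) ∞ (fun u : Z => (N.act u (σ (N.anchor u)), z))
        (N.anchor ⁻¹' V) :=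
      (hN.act.comp (contMDiff_id.contMDiffOn.prodMk h3) fun u hu => hs u hu).prodMk
        contMDiff_const.contMDiffOn
    have h5 : N.anchor (N.act (Ψ w).1 (Γ.inv γ)) = Γ.src γ := by
      rw [N.anchor_act _ _ (by rw [Γ.src_inv, h1]), Γ.tgt_inv]
    -- The section keeps `z` constant and lifts `u` to the pair of `u · σ` and the arrow `σ = σ (φ
    -- u)`, with `σ` now a local section of `s`.
    refine ⟨_, hV.preimage hN.anchor.continuous, ?_,
      fun u => (Ψ.symm (N.act u (σ (N.anchor u)), z), (σ (N.anchor u), z)),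
      (Ψ.symm.contMDiff.comp_contMDiffOn h4).prodMk (h3.prodMk contMDiff_const.contMDiffOn),
      ?_, fun u hu => ⟨(hP' _).2 ?_, ?_⟩⟩
    · change N.anchor (N.act (Ψ w).1 (Γ.inv γ)) ∈ V
      rwa [h5]
    · change (Ψ.symm (N.act (N.act (Ψ w).1 (Γ.inv γ)) (σ (N.anchor (N.act (Ψ w).1 (Γ.inv γ)))), z),
        (σ (N.anchor (N.act (Ψ w).1 (Γ.inv γ))), z)) = (w, (γ, z))
      rw [h5, hσγ, N.act_inv_act h1, ← h2, Prod.mk.eta, Ψ.symm_apply_apply]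
    · change N.anchor (Ψ (Ψ.symm _)).1 = Γ.tgt (σ (N.anchor u)) ∧ (Ψ (Ψ.symm _)).2 = z
      rw [Ψ.apply_symm_apply]
      exact ⟨N.anchor_act _ _ (hs u hu), rfl⟩
    · change N.act (Ψ (Ψ.symm _)).1 (Γ.inv (σ (N.anchor u))) = u
      rw [Ψ.apply_symm_apply]
      exact N.act_act_inv (hs u hu)
  · rintro C ⟨hC, Φ, hΦ⟩
    refine ⟨C, hC, Φ, ?_, ?_⟩
    · rintro ⟨p⟩
      rw [hΦ]
      exact (N.anchor_act _ _ (hP p)).trans (Γ.tgt_inv _)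
    · rintro ⟨p⟩ g h
      have h1 : Γ.src p.1.2.1 = Γ.src g := h
      have h3 : ((Γ.naturalBimodule Z).inverse.right.anchor p.1.2) = Γ.src g := h
      simp only [Bimodule.induced, h3, dif_pos]
      rw [hΦ, hΦ]
      change N.act (Ψ p.1.1).1 (Γ.inv (Γ.mul (Γ.inv g) p.1.2.1))
        = N.act (N.act (Ψ p.1.1).1 (Γ.inv p.1.2.1)) g
      rw [Γ.inv_mul_rev (by rw [Γ.tgt_inv, h1]), Γ.inv_inv,
        N.act_mul _ _ _ (hP p) (by rw [Γ.tgt_inv, h1])]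

end

end SetGroupoid

theorem mainTheorem7 {𝕜 : Type*} [RCLike 𝕜]
    {E₁ H₁ G : Type*} [NormedAddCommGroup E₁] [NormedSpace 𝕜 E₁] [FiniteDimensional 𝕜 E₁]
    [TopologicalSpace H₁] (I : ModelWithCorners 𝕜 E₁ H₁) [I.Boundaryless]
    [TopologicalSpace G] [ChartedSpace H₁ G] [IsManifold I ∞ G]
    {E₂ H₂ M : Type*} [NormedAddCommGroup E₂] [NormedSpace 𝕜 E₂] [FiniteDimensional 𝕜 E₂]
    [TopologicalSpace H₂] (J : ModelWithCorners 𝕜 E₂ H₂) [J.Boundaryless]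
    [TopologicalSpace M] [ChartedSpace H₂ M] [IsManifold J ∞ M]
    [T2Space M] [SecondCountableTopology M]
    {E₃ H₃ Z : Type*} [NormedAddCommGroup E₃] [NormedSpace 𝕜 E₃] [FiniteDimensional 𝕜 E₃]
    [TopologicalSpace H₃] (K : ModelWithCorners 𝕜 E₃ H₃) [K.Boundaryless]
    [TopologicalSpace Z] [ChartedSpace H₃ Z] [IsManifold K ∞ Z]
    [T2Space Z] [SecondCountableTopology Z]
    -- a Lie groupoid `Γ ⇉ M`
    (Γ : SetGroupoid G M) (hΓ : Γ.IsLie I J)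
    -- a nonempty embedded `Γ`-stable submanifold `S` of `M`
    (S : Set M) (hS : IsEmbeddedSubmanifold J S) (hΓS : Γ.IsStable S) (hS₀ : S.Nonempty)
    -- a `Γ`-resolution `(Z, φ)` of the closure of `S`, where `φ = N.anchor`
    (N : Γ.RightModule Z) (hN : N.IsEquivariantResolution I J K S) :
    -- `Γh` is the product groupoid, `X` the natural bimodule on `Γ × Z`, `Sh = S × Z`,
    -- `Nh` is `(Z × Z, φ × id)`, `L` is the graph of `φ`, and `R` is the set of arrows that the
    -- diagonal of `Z × Z` determines
    let Γh := Γ.prod (SetGroupoid.pair Z)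
    let X := Γ.naturalBimodule Z
    let Sh : Set (M × Z) := S ×ˢ Set.univ
    let Nh := N.hat
    let L : Set (M × Z) := Set.range fun z => (N.anchor z, z)
    let R : Set (G × (Z × Z)) := Nh.arrowsOf (Set.diagonal Z)
    let Ih := I.prod (K.prod K)
    let Jh := J.prod K
    let Kh := K.prod K
    -- `X` is a Morita equivalence of Lie groupoids, which takes `S` to `Sh`
    Γh.IsLie Ih Jh ∧ X.IsMorita I J Ih Jh (I.prod K) ∧
    X.mapStable S = Sh ∧ IsEmbeddedSubmanifold Jh Sh ∧ Γh.IsStable Sh ∧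
    -- `Nh` is a `Γh`-resolution of the closure of `Sh`; it is the one that corresponds to `N`
    -- under `X`
    Nh.IsEquivariantResolution Ih Jh Kh Sh ∧
    (∃ _ : ChartedSpace (ModelProd H₃ H₃) (X.Induced N),
      IsQuotientManifold (K.prod (I.prod K)) Kh (X.fibre N) (X.rel N) ∧
      (X.induced N).Coincide Kh Nh Kh) ∧
    -- the diagonal shows that `Nh` is `L`-compatible
    Nh.IsCompatibleVia Ih Jh Kh Sh L (Set.diagonal Z) ∧
    -- `R ⇉ L` is a closed Lie subgroupoid of `Γh`, full in `Sh`
    Γh.IsFullSubgroupoidIn Ih Jh R L Sh ∧ Γh.IsClosedIn R L ∧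
    -- `Z(R)` is a manifold and a `Γh`-resolution which coincides with `Nh`, and `X⁻¹ (Z(R))` is a
    -- manifold and a right `Γ`-module which coincides with `N`
    ∃ _ : ChartedSpace (ModelProd H₃ H₃) (Γh.ZQuot R L),
      IsQuotientManifold Ih Kh (Γh.src ⁻¹' L) (Γh.subRel R L) ∧
      (Γh.ZModule R L).IsEquivariantResolution Ih Jh Kh Sh ∧
      (Γh.ZModule R L).Coincide Kh Nh Kh ∧
      ∃ _ : ChartedSpace H₃ (X.inverse.Induced (Γh.ZModule R L)),
        IsQuotientManifold (Kh.prod (I.prod K)) K (X.inverse.fibre (Γh.ZModule R L))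
          (X.inverse.rel (Γh.ZModule R L)) ∧
        (X.inverse.induced (Γh.ZModule R L)).IsEquivariantResolution I J K S ∧
        (X.inverse.induced (Γh.ZModule R L)).Coincide K N K := by

  intro Γh X Sh Nh L R Ih Jh Kh
  -- Since `φ` maps onto the nonempty set `S`, there is a point of `Z`; this gives the surjectivity
  -- of `p`.
  have : Nonempty Z := by
    obtain ⟨m, hm⟩ := hS₀
    obtain ⟨z, -⟩ := hN.2.2.2.1.surjOn hm
    exact ⟨z⟩
  -- The manifold structure of `Z(R)` and its identification with `Z × Z` are inputs to the
  -- construction of the last quotient.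
  obtain ⟨C, hC, hCN⟩ := SetGroupoid.exists_zModule_arrowsOf_diagonal hΓ hN.1
  obtain ⟨D, hD, hDN⟩ := SetGroupoid.exists_induced_inverse_naturalBimodule hΓ hN.1 hCN
  exact ⟨hΓ.prod SetGroupoid.isLie_pair, SetGroupoid.naturalBimodule_isMorita hΓ,
    SetGroupoid.naturalBimodule_mapStable hΓS, hS.prod_univ, hΓS.prod_univ _, hN.hat,
    SetGroupoid.exists_induced_naturalBimodule hΓ hN.1, hN.isCompatibleVia_diagonal,
    hN.isFullSubgroupoidIn_arrowsOf_diagonal hΓ hS,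
    N.isClosedIn_arrowsOf_diagonal hΓ.src.contMDiff.continuous hN.1,
    C, hC, hCN.isEquivariantResolution hN.hat, hCN, D, hD, hDN.isEquivariantResolution hN, hDN⟩
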